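/- Fix an irrational real number $\alpha$ with $0<\alpha<1$. Let $M$ be a (simple) graph, let $A\subseteq B$ be finite sets of vertices of $M$, and let $\lambda$ be an equivalence relation on $B\setminus A$. Put $w_\lambda(A,B)=v-\alpha e$, where $v$ is the number of $\lambda$-classes and $e$ is the number of edges of $M$ that are contained in $B$ but neither in $A$ nor in a single $\lambda$-class. Write - $A<^*_c B$ if $A\subsetneq B$ and $w_\lambda(A,B)<0$ for every equivalence relation $\lambda$ on $B\setminus A$; - $A\le^*_i B$ if $A\subseteq B$ and $A'<^*_c B$ for all $A'$ with $A\subseteq A'\subsetneq B$; and $A<^*_i B$ if moreover $A\ne B$; - $A\le^*_s B$, where now $A$ is finite and $B\supseteq A$ is an arbitrary set of vertices, if there is no finite $C\subseteq B$ with $A<^*_i C$. For a set $A$ of vertices of $M$ and $k,m\in\mathbb N$ let $\mathrm{cl}^k(A,M)$ be the union of $A$ and of all sets $C$ of vertices with $|C|\le k$ and $C\cap A\le^*_i C$; let $\mathrm{cl}^{k,0}(A,M)=A$ and $\mathrm{cl}^{k,m+1}(A,M)=\mathrm{cl}^k(\mathrm{cl}^{k,m}(A,M),M)$. Sets $X,Y$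 of vertices are free over $B$ inside $M$ if $X\cap Y=B$ and no edge of $M$ joins $X\setminus B$ to $Y\setminus B$. A finite sequence $\bar a$ of vertices is identified with the set of its entries where a set is needed. **Lemma 3.11.** For all $k,m,\ell\in\mathbb N$ there are $m^*,k^*,t^*\in\mathbb N$ such that the following holds. For every graph $M$, every sequence $\bar a$ of at most $\ell$ vertices of $M$ and every vertex $b\in M\setminus \mathrm{cl}^{k^*,m^*}(\bar a,M)$, there are $m^\otimes\in\mathbb N$ with $m^\otimes+m\le m^*$ and a finite set $B$ of vertices of $M$ such that (i) $|B|\le t^*$; (ii) $\bar a\subseteq B\subseteq \mathrm{cl}^k(B,M)\subseteq \mathrm{cl}^{k^*,m^\otimes}(\bar a,M)$; (iii) $\mathrm{cl}^{k^*,m^\otimes+m}(\bar a,M)$ and $B^*:=\bigl(\mathrm{cl}^k(\bar a b,M)\setminus \mathrm{cl}^{k^*,m^\otimes+m}(\bar a,M)\bigr)\cup B$ are free over $B$ inside $M$; (iv) $B\le^*_s B^*$. -/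

import Mathlib

namespace WeightedGraph

variable {V : Type*}

/-- The number of classes of the equivalence relation `r`, restricted to `B \ A`.  Equivalence
relations on `B \ A` are given here as restrictions of equivalence relations on the whole vertex
set (every equivalence relation on `B \ A` is such a restriction); only the restriction of `r` to
`B \ A` matters. -/
noncomputable def classCount (A B : Finset V) (r : Setoid V) : ℕ :=
  open scoped Classical in ((B \ A).image (Quotient.mk r)).card

/-- The edges of `M` inside `B` that are not contained in `A` and not contained in a class of the
restriction of `r` to `B \ A`. -/
noncomputable def longEdges (M : SimpleGraph V) (A B : Finset V) (r : Setoid V) :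
    Finset (Sym2 V) :=
  open scoped Classical in
  B.sym2.filter fun e => e ∈ M.edgeSet ∧ (¬ ∀ y ∈ e, y ∈ A) ∧
    ¬ ∃ x ∈ B \ A, ∀ y ∈ e, y ∈ B \ A ∧ r x y

/-- The weight `w_r(A, B) = v_r(A, B) - α e_r(A, B)`. -/
noncomputable def weight (α : ℝ) (M : SimpleGraph V) (A B : Finset V) (r : Setoid V) : ℝ :=
  (classCount A B r : ℝ) - α * ((longEdges M A B r).card : ℝ)

/-- `A <*_c B`, for finite sets of vertices of `M` (with the induced graphs). -/
def LTc (α : ℝ) (M : SimpleGraph V) (A B : Finset V) : Prop :=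
  A ⊂ B ∧ ∀ r : Setoid V, weight α M A B r < 0

/-- `A ≤*_i B`, for finite sets of vertices of `M`. -/
def LEi (α : ℝ) (M : SimpleGraph V) (A B : Finset V) : Prop :=
  A ⊆ B ∧ ∀ A' : Finset V, A ⊆ A' → A' ⊂ B → LTc α M A' B

/-- `A ≤*_s B`: there is no `C` with `A <*_i C ≤ B`.  The set `B` of vertices may be infinite (if
`M` is); then `C` ranges over its finite subsets. -/
def LEs (α : ℝ) (M : SimpleGraph V) (A : Finset V) (B : Set V) : Prop :=
  (A : Set V) ⊆ B ∧ ∀ C : Finset V, (C : Set V) ⊆ B → ¬ (LEi α M A C ∧ A ≠ C)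

/-- `cl^k(A, M)`: the set `A` together with all `C ⊆ M` such that `|C| ≤ k` and `C ∩ A ≤*_i C`.
(For `1 ≤ k` the singletons `C ⊆ A` already contribute `A`.) -/
def cl (α : ℝ) (M : SimpleGraph V) (k : ℕ) (A : Set V) : Set V :=
  A ∪ {x | ∃ C : Finset V, C.card ≤ k ∧ x ∈ C ∧
    open scoped Classical in LEi α M (C.filter fun y => y ∈ A) C}

/-- `cl^{k,m}(A, M)`, the `m`-fold iteration of `cl^k`. -/
def clIter (α : ℝ) (M : SimpleGraph V) (k : ℕ) : ℕ → Set V → Set V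
  | 0, A => A
  | m + 1, A => cl α M k (clIter α M k m A)

/-- `X` and `Y` are free over `B` inside `M`: they meet exactly in `B`, and no edge of `M` joins
`X \ B` to `Y \ B`. -/
def FreeOver (M : SimpleGraph V) (X Y B : Set V) : Prop :=
  X ∩ Y = B ∧ ∀ x ∈ X \ B, ∀ y ∈ Y \ B, ¬ M.Adj x y

end WeightedGraph

/-! Fix `δ > 0` such that replacing `α` by `α - δ` turns no negative weight with at most `k` classes
positive (`exists_gap`). Adjoining sets `C` with `|C| ≤ k` and `C ∩ Q ≤*_i C` then lowers the weight
by at least `δ` for each new long edge (`weight_le_of_cover`). The vertex `b` contributes at most 1,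
so a set generated by such `C` over a base and `b`, with nonnegative weight over the base, has at
most `1/δ` long edges.

Write `s` for the set of entries of the sequence and `X_i` for `cl^{K,i}(s)`. If `b ∉ X_g` and `i <
g`, at most `c` edges join `X_i` to `cl^k(sb) \ X_g`, with `c` independent of `K`
(`crossing_finite`). A pigeonhole over stages and dyadic scales gives a stage `j = i + m + 1` at
which every vertex of `X_j` adjacent to `cl^k(sb) \ X_j` already lies in `X_i`
(`exists_stable_boundary`). Let `B` be `s` together with these boundary vertices. Freeness is
immediate, and `cl^k(B) ⊆ X_{i+1}`.

For strength (`les_of_boundary_subset`), an extension `B <*_i G` may be arbitrarily large, but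
`exists_bounded_ltc` extracts from it one of bounded size. For large `K` that extension is swallowed
by `X_{i+1}`, although its new vertices lie outside `X_j`. -/

namespace WeightedGraph

open scoped Classical

/-! ### Weights, the relations `<*_c` and `≤*_i`, and the gap `δ`. -/

section Basics

variable {V : Type*} {M : SimpleGraph V} {α : ℝ}

theorem mk_mem_longEdges {A B : Finset V} {r : Setoid V} {x y : V} :
    s(x, y) ∈ longEdges M A B r ↔ x ∈ B ∧ y ∈ B ∧ M.Adj x y ∧ ¬ (x ∈ A ∧ y ∈ A) ∧
      ¬ (x ∉ A ∧ y ∉ A ∧ r x y) := by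
  simp only [longEdges, Finset.mem_filter, Finset.mk_mem_sym2_iff, SimpleGraph.mem_edgeSet,
    Sym2.mem_iff, forall_eq_or_imp, forall_eq, Finset.mem_sdiff]
  constructor
  · rintro ⟨⟨hx, hy⟩, hadj, hA, hr⟩
    refine ⟨hx, hy, hadj, hA, fun h => hr ⟨x, ⟨hx, h.1⟩, ⟨⟨hx, h.1⟩, r.refl' x⟩,
      ⟨hy, h.2.1⟩, h.2.2⟩⟩
  · rintro ⟨hx, hy, hadj, hA, hr⟩
    refine ⟨⟨hx, hy⟩, hadj, hA, ?_⟩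
    rintro ⟨z, -, ⟨h1, h2⟩, h3, h4⟩
    exact hr ⟨h1.2, h3.2, r.trans' (r.symm' h2) h4⟩

theorem classCount_mono {A B B' : Finset V} (h : B ⊆ B') (r : Setoid V) :
    classCount A B r ≤ classCount A B' r :=
  Finset.card_le_card (Finset.image_subset_image (Finset.sdiff_subset_sdiff h subset_rfl))

theorem classCount_le_card (A B : Finset V) (r : Setoid V) :
    classCount A B r ≤ (B \ A).card :=
  Finset.card_image_le

theorem longEdges_mono {A B B' : Finset V} (h : B ⊆ B') (r : Setoid V) :
    longEdges M A B r ⊆ longEdges M A B' r := by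
  intro e
  induction e with | _ x y =>
  simp only [mk_mem_longEdges]
  exact fun ⟨hx, hy, h'⟩ => ⟨h hx, h hy, h'⟩

/-- Fewer classes and more long edges make the weight smaller. -/
theorem weight_le_weight {β : ℝ} (hβ : 0 ≤ β) {A A' B B' : Finset V} {r r' : Setoid V}
    (hv : classCount A' B' r' ≤ classCount A B r)
    (he : longEdges M A B r ⊆ longEdges M A' B' r') :
    weight β M A' B' r' ≤ weight β M A B r := by
  have h1 : (classCount A' B' r' : ℝ) ≤ classCount A B r := by exact_mod_cast hv
  have h2 : ((longEdges M A B r).card : ℝ) ≤ (longEdges M A' B' r').card := by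
    exact_mod_cast Finset.card_le_card he
  have := mul_le_mul_of_nonneg_left h2 hβ
  unfold weight
  linarith

theorem weight_self (A : Finset V) (r : Setoid V) : weight α M A A r = 0 := by
  have : longEdges M A A r = ∅ := by
    rw [Finset.eq_empty_iff_forall_notMem]
    intro e
    induction e with | _ x y =>
    rw [mk_mem_longEdges]
    tauto
  simp [weight, this, classCount]

/-- With a single class and no edge to `A` there would be no long edges, and the weight could not be
negative. -/
theorem LTc.exists_adj {A B : Finset V} (h : LTc α M A B) :
    ∃ x ∈ B \ A, ∃ y ∈ A, M.Adj x y := by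
  by_contra! hno
  have hw := h.2 ⊤
  have he : longEdges M A B ⊤ = ∅ := by
    rw [Finset.eq_empty_iff_forall_notMem]
    intro e
    induction e with | _ x y =>
    rw [mk_mem_longEdges]
    rintro ⟨hx, hy, hadj, h1, h2⟩
    by_cases hxA : x ∈ A
    · exact hno y (by simp_all) x hxA hadj.symm
    · by_cases hyA : y ∈ A
      · exact hno x (by simp_all) y hyA hadj
      · exact h2 ⟨hxA, hyA, trivial⟩
  rw [weight, he] at hw
  have : (0 : ℝ) ≤ classCount A B ⊤ := by positivity
  simp at hw
  linarith

theorem LEi.refl (A : Finset V) : LEi α M A A :=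
  ⟨subset_rfl, fun _ h1 h2 => absurd h1 h2.2⟩

theorem LEi.mono_base {A A' B : Finset V} (h : LEi α M A B) (hA : A ⊆ A') (hB : A' ⊆ B) :
    LEi α M A' B :=
  ⟨hB, fun D h1 h2 => h.2 D (hA.trans h1) h2⟩

theorem LEi.ltc {A B : Finset V} (h : LEi α M A B) (hne : A ≠ B) : LTc α M A B :=
  h.2 A subset_rfl (h.1.ssubset_of_ne hne)

/-- Passing from `B` to a part `U` whose vertices outside `R` have no neighbours in `B \ U`. -/
theorem LEi.restrict (hα : 0 ≤ α) {A B U R : Finset V} (h : LEi α M A B) (hU : U ⊆ B) (hR : R ⊆ U)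
    (hA : A ∩ U ⊆ R) (hadj : ∀ x ∈ U \ R, ∀ y ∈ B \ U, ¬ M.Adj x y) : LEi α M R U := by
  refine ⟨hR, fun P hP hPU => ⟨hPU, fun r => ?_⟩⟩
  -- The hypothesis is applied to the base `P ∪ (B \ U)`: what is left of `B` is `U \ P`, and its
  -- vertices have no neighbours in `B \ U`.
  have hsub : A ⊆ P ∪ (B \ U) := by
    intro x hx
    by_cases hxU : x ∈ U
    · exact Finset.mem_union_left _ (hP (hA (by simp [hx, hxU])))
    · exact Finset.mem_union_right _ (by simp [h.1 hx, hxU])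
  have hss : P ∪ (B \ U) ⊂ B := by
    obtain ⟨z, hzU, hzP⟩ := Finset.exists_of_ssubset hPU
    refine Finset.ssubset_iff_subset_ne.2
      ⟨Finset.union_subset (hPU.1.trans hU) Finset.sdiff_subset, fun heq => ?_⟩
    have : z ∈ P ∪ (B \ U) := by rw [heq]; exact hU hzU
    simp [hzU, hzP] at this
  refine lt_of_le_of_lt (weight_le_weight hα ?_ ?_) ((h.2 _ hsub hss).2 r)
  · refine Finset.card_le_card (Finset.image_subset_image ?_)
    intro x hx
    simp only [Finset.mem_sdiff, Finset.mem_union, not_or, not_and, not_not] at hx ⊢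
    exact ⟨hU hx.1, hx.2, fun _ => hx.1⟩
  · intro e
    induction e with | _ x y =>
    simp only [mk_mem_longEdges, Finset.mem_union, Finset.mem_sdiff]
    have key : ∀ x y, x ∈ B → y ∈ B → M.Adj x y → ¬ (x ∈ P ∨ x ∈ B ∧ x ∉ U) → x ∈ U ∧ y ∈ U := by
      intro x y hx hy hxy hn
      have hxU : x ∈ U := by tauto
      refine ⟨hxU, ?_⟩
      by_contra hyU
      exact hadj x (by simp only [Finset.mem_sdiff]; exact ⟨hxU, fun h => hn (Or.inl (hP h))⟩) y
        (by simp [hy, hyU]) hxy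
    rintro ⟨hx, hy, hxy, h1, h2⟩
    have : x ∈ U ∧ y ∈ U := by
      rcases not_and_or.1 h1 with h | h
      · exact key x y hx hy hxy h
      · exact (key y x hy hx hxy.symm h).symm
    tauto

/-- `A ≤*_i B` is preserved under adding vertices to the base. -/
theorem LEi.union (hα : 0 ≤ α) {A B D : Finset V} (h : LEi α M A B) (hAD : A ⊆ D) :
    LEi α M D (D ∪ B) := by
  refine ⟨Finset.subset_union_left, fun P hP hPU => ⟨hPU, fun r => ?_⟩⟩
  have hss : P ∩ B ⊂ B := by
    obtain ⟨z, hz, hzP⟩ := Finset.exists_of_ssubset hPU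
    refine Finset.ssubset_iff_subset_ne.2 ⟨Finset.inter_subset_right, fun heq => ?_⟩
    have hzB : z ∈ B := (Finset.mem_union.1 hz).resolve_left fun h => hzP (hP h)
    rw [← heq] at hzB
    exact hzP (Finset.mem_inter.1 hzB).1
  refine lt_of_le_of_lt (weight_le_weight hα ?_ ?_)
    ((h.2 _ (Finset.subset_inter (hAD.trans hP) h.1) hss).2 r)
  · refine Finset.card_le_card (Finset.image_subset_image ?_)
    intro x hx
    have := @hP x
    simp only [Finset.mem_sdiff, Finset.mem_union, Finset.mem_inter, not_and] at hx ⊢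
    tauto
  · intro e
    induction e with | _ x y =>
    simp only [mk_mem_longEdges, Finset.mem_union, Finset.mem_inter]
    tauto

/-- Weights drop along extensions by sets `C` of bounded size with `C ∩ Q ≤*_i C`, even for a
slightly smaller edge density `β`. -/
theorem weight_le_of_cover {β : ℝ} (hβ : 0 ≤ β) {k : ℕ}
    (hk : ∀ v ≤ k, ∀ e : ℕ, (v : ℝ) - α * e < 0 → (v : ℝ) - β * e ≤ 0)
    {A T : Finset V} (r : Setoid V) : ∀ (n : ℕ) (Q : Finset V), (T \ Q).card = n → A ⊆ Q → Q ⊆ T →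
    (∀ z ∈ T \ Q, ∃ C ⊆ T, z ∈ C ∧ C.card ≤ k ∧ LEi α M (C ∩ Q) C) →
    weight β M A T r ≤ weight β M A Q r := by
  intro n
  induction n using Nat.strong_induction_on with
  | _ n ih =>
  intro Q hn hAQ hQT hC
  rcases hQT.eq_or_ssubset with rfl | hss
  · exact le_rfl
  obtain ⟨z₀, hz₀T, hz₀Q⟩ := Finset.exists_of_ssubset hss
  have step : ∀ Q', Q ⊂ Q' → Q' ⊆ T → weight β M A Q' r ≤ weight β M A Q r →
      weight β M A T r ≤ weight β M A Q r := by
    intro Q' hQQ' hQ'T hw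
    refine (ih _ ?_ Q' rfl (hAQ.trans hQQ'.1) hQ'T ?_).trans hw
    · rw [← hn]
      refine Finset.card_lt_card ⟨Finset.sdiff_subset_sdiff subset_rfl hQQ'.1, fun hsub => ?_⟩
      obtain ⟨y, hy, hyQ⟩ := Finset.exists_of_ssubset hQQ'
      exact (Finset.mem_sdiff.1 (hsub (Finset.mem_sdiff.2 ⟨hQ'T hy, hyQ⟩))).2 hy
    · intro z hz
      obtain ⟨C, h1, h2, h3, h4⟩ := hC z (Finset.sdiff_subset_sdiff subset_rfl hQQ'.1 hz)
      exact ⟨C, h1, h2, h3, h4.mono_base (Finset.inter_subset_inter subset_rfl hQQ'.1)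
        Finset.inter_subset_left⟩
  -- A vertex equivalent to one of `Q \ A` is adjoined alone: it brings no new class.
  by_cases hsat : ∃ z ∈ T \ Q, ∃ q ∈ Q \ A, r z q
  · obtain ⟨z, hz, q, hq, hzq⟩ := hsat
    rw [Finset.mem_sdiff] at hz
    refine step (insert z Q) (Finset.ssubset_insert hz.2) (Finset.insert_subset hz.1 hQT)
      (weight_le_weight hβ ?_ (longEdges_mono (Finset.subset_insert _ _) r))
    refine Finset.card_le_card fun c hc => ?_
    obtain ⟨y, hy, rfl⟩ := Finset.mem_image.1 hc
    rw [Finset.mem_image]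
    rw [Finset.mem_sdiff, Finset.mem_insert] at hy
    rcases hy.1 with rfl | hyQ
    · exact ⟨q, hq, Quotient.sound (r.symm' hzq)⟩
    · exact ⟨y, Finset.mem_sdiff.2 ⟨hyQ, hy.2⟩, rfl⟩
  -- Now no class meets both `Q \ A` and `T \ Q`, so every long edge of `C` over `C ∩ Q` is a new
  -- long edge over `A`, and the weights add up.
  · push Not at hsat
    obtain ⟨C, hCT, hzC, hCk, hCi⟩ := hC z₀ (Finset.mem_sdiff.2 ⟨hz₀T, hz₀Q⟩)
    have hlt := (hCi.ltc fun h => hz₀Q (Finset.mem_inter.1 (h.symm ▸ hzC)).2).2 r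
    refine step (Q ∪ C) ⟨Finset.subset_union_left, fun h => hz₀Q (h (by simp [hzC]))⟩
      (Finset.union_subset hQT hCT) ?_
    have hle := hk _ ((classCount_le_card (C ∩ Q) C r).trans
      ((Finset.card_le_card Finset.sdiff_subset).trans hCk)) _ hlt
    have hv : classCount A (Q ∪ C) r ≤ classCount A Q r + classCount (C ∩ Q) C r := by
      refine (Finset.card_le_card ?_).trans (Finset.card_union_le _ _)
      rw [← Finset.image_union]
      refine Finset.image_subset_image fun x hx => ?_
      simp only [Finset.mem_sdiff, Finset.mem_union, Finset.mem_inter] at hx ⊢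
      tauto
    have he : (longEdges M A Q r).card + (longEdges M (C ∩ Q) C r).card ≤
        (longEdges M A (Q ∪ C) r).card := by
      rw [← Finset.card_union_of_disjoint]
      · refine Finset.card_le_card (Finset.union_subset
          (longEdges_mono Finset.subset_union_left r) fun e => ?_)
        induction e with | _ x y =>
        simp only [mk_mem_longEdges, Finset.mem_union, Finset.mem_inter]
        rintro ⟨hx, hy, hxy, h1, h2⟩
        refine ⟨Or.inr hx, Or.inr hy, hxy, fun h => h1 ⟨⟨hx, hAQ h.1⟩, ⟨hy, hAQ h.2⟩⟩, ?_⟩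
        rintro ⟨hxA, hyA, hr⟩
        have hsx := hsat x
        have hsy := hsat y
        simp only [Finset.mem_sdiff] at hsx hsy
        by_cases hxQ : x ∈ Q
        · exact hsy ⟨hCT hy, fun hyQ => h1 ⟨⟨hx, hxQ⟩, hy, hyQ⟩⟩ x ⟨hxQ, hxA⟩ (r.symm' hr)
        · by_cases hyQ : y ∈ Q
          · exact hsx ⟨hCT hx, hxQ⟩ y ⟨hyQ, hyA⟩ hr
          · exact h2 ⟨fun h => hxQ h.2, fun h => hyQ h.2, hr⟩
      · rw [Finset.disjoint_left]
        intro e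
        induction e with | _ x y =>
        simp only [mk_mem_longEdges, Finset.mem_inter]
        tauto
    have hv' : (classCount A (Q ∪ C) r : ℝ) ≤ classCount A Q r + classCount (C ∩ Q) C r := by
      exact_mod_cast hv
    have he' : ((longEdges M A Q r).card : ℝ) + (longEdges M (C ∩ Q) C r).card ≤
        (longEdges M A (Q ∪ C) r).card := by
      exact_mod_cast he
    have := mul_le_mul_of_nonneg_left he' hβ
    unfold weight
    linarith

/-- Over an intermediate `P`, the weight is negative at `P ∪ B` by `LEi.union`; it does not increase
from there to `C`, with `C` itself as the only covering set. -/
theorem LEi.trans (hα : 0 ≤ α) {A B C : Finset V} (h : LEi α M A B) (h' : LEi α M B C) :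
    LEi α M A C := by
  refine ⟨h.1.trans h'.1, fun P hP hPC => ?_⟩
  by_cases hBP : B ⊆ P
  · exact h'.2 P hBP hPC
  refine ⟨hPC, fun r => ?_⟩
  have h1 := ((h.union hα hP).ltc fun heq => hBP (heq ▸ Finset.subset_union_right)).2 r
  refine lt_of_le_of_lt (weight_le_of_cover hα (k := C.card) (fun _ _ _ h => h.le) r _ (P ∪ B) rfl
    Finset.subset_union_left (Finset.union_subset hPC.1 h'.1) fun z hz => ?_) h1
  exact ⟨C, subset_rfl, (Finset.mem_sdiff.1 hz).1, le_rfl,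
    h'.mono_base (Finset.subset_inter h'.1 Finset.subset_union_right) Finset.inter_subset_left⟩

/-- Weights along a chain `A ⊆ P ⊆ B` add up for a suitable equivalence relation on `B \ A`. -/
theorem exists_weight_add_le (hα : 0 ≤ α) {A P B : Finset V} (hAP : A ⊆ P) (hPB : P ⊆ B)
    (r r' : Setoid V) :
    ∃ q : Setoid V, weight α M A P r + weight α M P B r' ≤ weight α M A B q := by
  -- The sum type keeps classes inside `P` apart from those outside, so edges leaving `P` stay long.
  let f : V → Quotient r ⊕ Quotient r' := fun x =>
    if x ∈ P then Sum.inl (Quotient.mk r x) else Sum.inr (Quotient.mk r' x)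
  have hf1 : ∀ x ∈ P, f x = Sum.inl (Quotient.mk r x) := fun x hx => if_pos hx
  have hf2 : ∀ x ∉ P, f x = Sum.inr (Quotient.mk r' x) := fun x hx => if_neg hx
  refine ⟨Setoid.ker f, ?_⟩
  have hv : classCount A P r + classCount P B r' ≤ classCount A B (Setoid.ker f) := by
    have h1 : classCount A B (Setoid.ker f) = ((B \ A).image f).card := by
      have : (B \ A).image f = ((B \ A).image (Quotient.mk (Setoid.ker f))).image
          (Setoid.kerLift f) := by
        rw [Finset.image_image]; rfl
      rw [this, Finset.card_image_of_injective]
      · rfl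
      · exact Setoid.kerLift_injective f
    have h2 : ((P \ A).image (Quotient.mk r)).disjSum ((B \ P).image (Quotient.mk r')) ⊆
        (B \ A).image f := by
      intro s hs
      rw [Finset.mem_disjSum] at hs
      rw [Finset.mem_image]
      rcases hs with ⟨c, hc, rfl⟩ | ⟨c, hc, rfl⟩
      · obtain ⟨x, hx, rfl⟩ := Finset.mem_image.1 hc
        rw [Finset.mem_sdiff] at hx
        exact ⟨x, Finset.mem_sdiff.2 ⟨hPB hx.1, hx.2⟩, hf1 x hx.1⟩
      · obtain ⟨x, hx, rfl⟩ := Finset.mem_image.1 hc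
        rw [Finset.mem_sdiff] at hx
        exact ⟨x, Finset.mem_sdiff.2 ⟨hx.1, fun h => hx.2 (hAP h)⟩, hf2 x hx.2⟩
    have h3 := Finset.card_le_card h2
    rw [Finset.card_disjSum] at h3
    rw [h1]
    exact h3
  have he : (longEdges M A B (Setoid.ker f)).card ≤
      (longEdges M A P r).card + (longEdges M P B r').card := by
    refine (Finset.card_le_card fun e => ?_).trans (Finset.card_union_le _ _)
    induction e with | _ x y =>
    simp only [Finset.mem_union, mk_mem_longEdges, Setoid.ker_def]
    rintro ⟨hx, hy, hxy, h1, h2⟩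
    by_cases hP : x ∈ P ∧ y ∈ P
    · refine Or.inl ⟨hP.1, hP.2, hxy, h1, fun h => h2 ⟨h.1, h.2.1, ?_⟩⟩
      rw [hf1 x hP.1, hf1 y hP.2, Quotient.sound h.2.2]
    · refine Or.inr ⟨hx, hy, hxy, hP, fun h => h2 ⟨fun h' => h.1 (hAP h'),
        fun h' => h.2.1 (hAP h'), ?_⟩⟩
      rw [hf2 x h.1, hf2 y h.2.1, Quotient.sound h.2.2]
  have hv' : (classCount A P r : ℝ) + classCount P B r' ≤ classCount A B (Setoid.ker f) := by
    exact_mod_cast hv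
  have he' : ((longEdges M A B (Setoid.ker f)).card : ℝ) ≤
      (longEdges M A P r).card + (longEdges M P B r').card := by
    exact_mod_cast he
  have := mul_le_mul_of_nonneg_left he' hα
  unfold weight
  linarith

/-- If `A ≤*_i B` fails at `P`, some relation has nonnegative weight on `B` over `P`; additivity
then gives `A <*_c P`, and `P` is smaller. -/
theorem LTc.exists_lei (hα : 0 ≤ α) {A B : Finset V} (h : LTc α M A B) :
    ∃ P ⊆ B, LEi α M A P ∧ A ≠ P := by
  induction hn : B.card using Nat.strong_induction_on generalizing B with
  | _ n ih =>
  by_cases hi : LEi α M A B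
  · exact ⟨B, subset_rfl, hi, h.1.ne⟩
  have : ∃ P, A ⊆ P ∧ P ⊂ B ∧ ¬ LTc α M P B := by
    by_contra! hno
    exact hi ⟨h.1.1, hno⟩
  obtain ⟨P, hAP, hPB, hP⟩ := this
  have : ∃ r', 0 ≤ weight α M P B r' := by
    by_contra! hno
    exact hP ⟨hPB, hno⟩
  obtain ⟨r', hr'⟩ := this
  have hlt : ∀ r, weight α M A P r < 0 := by
    intro r
    obtain ⟨q, hq⟩ := exists_weight_add_le (M := M) hα hAP hPB.1 r r'
    have := h.2 q
    linarith
  have hne : A ≠ P := by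
    rintro rfl
    have := hlt ⊤
    rw [weight_self] at this
    exact lt_irrefl _ this
  obtain ⟨P', h1, h2, h3⟩ := ih P.card (hn ▸ Finset.card_lt_card hPB)
    ⟨hAP.ssubset_of_ne hne, hlt⟩ rfl
  exact ⟨P', h1.trans hPB.1, h2, h3⟩

/-- A maximal `≤*_i`-extension of `A` inside `D`. -/
theorem exists_maximal_lei (hα : 0 ≤ α) {A P D : Finset V} (hP : LEi α M A P) (hPD : P ⊆ D) :
    ∃ E, P ⊆ E ∧ E ⊆ D ∧ LEi α M A E ∧ (E ≠ D → ∃ r, 0 ≤ weight α M E D r) := by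
  induction hn : (D \ P).card using Nat.strong_induction_on generalizing P with
  | _ n ih =>
  by_cases hw : P ≠ D → ∃ r, 0 ≤ weight α M P D r
  · exact ⟨P, subset_rfl, hPD, hP, hw⟩
  push Not at hw
  obtain ⟨P', h1, h2, h3⟩ := LTc.exists_lei hα ⟨hPD.ssubset_of_ne hw.1, hw.2⟩
  have hlt : (D \ P').card < n := by
    rw [← hn]
    refine Finset.card_lt_card ⟨Finset.sdiff_subset_sdiff subset_rfl h2.1, fun hsub => h3 ?_⟩
    refine h2.1.antisymm fun x hx => ?_
    by_contra hxP
    exact (Finset.mem_sdiff.1 (hsub (Finset.mem_sdiff.2 ⟨h1 hx, hxP⟩))).2 hx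
  obtain ⟨E, h4, h5⟩ := ih _ hlt (hP.trans hα h2) h1 rfl
  exact ⟨E, h2.1.trans h4, h5⟩

/-- The gap by which the edge density can be lowered without affecting the sign of the weights
with at most `k` classes. -/
theorem exists_gap (hα : 0 < α) (k : ℕ) :
    ∃ δ : ℝ, 0 < δ ∧ δ ≤ α ∧
      ∀ v ≤ k, ∀ e : ℕ, (v : ℝ) - α * e < 0 → (v : ℝ) - (α - δ) * e ≤ 0 := by
  have single : ∀ v : ℕ, ∃ δ : ℝ, 0 < δ ∧ δ ≤ α ∧
      ∀ e : ℕ, (v : ℝ) - α * e < 0 → (v : ℝ) - (α - δ) * e ≤ 0 := by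
    intro v
    -- `e₀` is the least `e` with `v < α * e`; the lowered density is `v / e₀`.
    set e₀ : ℕ := ⌊(v : ℝ) / α⌋₊ + 1 with he₀
    have hpos : (0 : ℝ) < e₀ := by positivity
    have hlt : (v : ℝ) < α * e₀ := by
      have := Nat.lt_floor_add_one ((v : ℝ) / α)
      rw [div_lt_iff₀ hα] at this
      push_cast [he₀]
      linarith
    refine ⟨α - v / e₀, ?_, ?_, fun e he => ?_⟩
    · rw [sub_pos, div_lt_iff₀ hpos]
      exact hlt
    · have : 0 ≤ (v : ℝ) / e₀ := by positivity
      linarith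
    · have hle : e₀ ≤ e := by
        rw [he₀, Nat.add_one_le_iff, Nat.floor_lt (by positivity), div_lt_iff₀ hα]
        linarith
      have hle' : (e₀ : ℝ) ≤ e := by exact_mod_cast hle
      have : (v : ℝ) = v / e₀ * e₀ := by field_simp
      have h2 : (v : ℝ) / e₀ * e₀ ≤ v / e₀ * e := mul_le_mul_of_nonneg_left hle' (by positivity)
      rw [sub_sub_cancel]
      linarith
  choose d hd0 hdα hd using single
  induction k with
  | zero =>
    refine ⟨d 0, hd0 0, hdα 0, fun v hv => ?_⟩
    obtain rfl : v = 0 := by omega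
    exact hd 0
  | succ k ih =>
    obtain ⟨δ, h0, h1, h2⟩ := ih
    refine ⟨min δ (d (k + 1)), lt_min h0 (hd0 _), (min_le_left _ _).trans h1, ?_⟩
    intro v hv e he
    have hen : (0 : ℝ) ≤ e := by positivity
    rcases Nat.lt_or_ge v (k + 1) with h | h
    · have := h2 v (by omega) e he
      have := mul_le_mul_of_nonneg_right (min_le_left δ (d (k + 1))) hen
      linarith
    · obtain rfl : v = k + 1 := by omega
      have := hd (k + 1) e he
      have := mul_le_mul_of_nonneg_right (min_le_right δ (d (k + 1))) hen
      linarith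

/-- Few long edges when the weight over a base generating everything is nonnegative. -/
theorem card_longEdges_le {δ : ℝ} (hδα : δ ≤ α) {k : ℕ}
    (hk : ∀ v ≤ k, ∀ e : ℕ, (v : ℝ) - α * e < 0 → (v : ℝ) - (α - δ) * e ≤ 0)
    {A T : Finset V} {b : V} {r : Setoid V} (hAT : A ⊆ T) (hb : b ∈ T)
    (hC : ∀ z ∈ T, z ∉ A → z ≠ b →
      ∃ C ⊆ T, z ∈ C ∧ C.card ≤ k ∧ LEi α M (C ∩ insert b A) C)
    (hw : 0 ≤ weight α M A T r) : δ * (longEdges M A T r).card ≤ 1 := by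
  have h1 : weight (α - δ) M A T r ≤ weight (α - δ) M A (insert b A) r := by
    refine weight_le_of_cover (sub_nonneg.2 hδα) hk r _ _ rfl (Finset.subset_insert _ _)
      (Finset.insert_subset hb hAT) fun z hz => ?_
    simp only [Finset.mem_sdiff, Finset.mem_insert, not_or] at hz
    exact hC z hz.1 hz.2.2 hz.2.1
  have h2 : weight (α - δ) M A (insert b A) r ≤ 1 := by
    have h3 : classCount A (insert b A) r ≤ 1 := by
      refine (classCount_le_card _ _ _).trans ?_
      refine (Finset.card_le_card (t := {b}) fun x hx => ?_).trans (by simp)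
      simp only [Finset.mem_sdiff, Finset.mem_insert, Finset.mem_singleton] at hx ⊢
      tauto
    have h4 : (classCount A (insert b A) r : ℝ) ≤ 1 := by exact_mod_cast h3
    have h5 : 0 ≤ (α - δ) * ((longEdges M A (insert b A) r).card : ℝ) :=
      mul_nonneg (sub_nonneg.2 hδα) (by positivity)
    unfold weight
    linarith
  unfold weight at h1 h2 hw
  linarith

end Basics

/-! ### Clean extensions and bounded witnesses for `<*_c`. -/

section CleanExtension

variable {V : Type*} {M : SimpleGraph V} {α : ℝ}

/-- `r` extends the restriction of `f` to `Q \ A` to an equivalence relation on `T \ A` without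
new classes and without new long edges. -/
def CleanExt (M : SimpleGraph V) (A Q T : Finset V) (f r : Setoid V) : Prop :=
  (∀ x ∈ Q \ A, ∀ y ∈ Q \ A, (r x y ↔ f x y)) ∧ (∀ z ∈ T, z ∉ A → ∃ q ∈ Q \ A, r z q) ∧
    ∀ x ∈ T, ∀ y ∈ T, M.Adj x y → x ∉ Q → y ∉ A ∧ r x y

theorem CleanExt.mono {A Q T T' : Finset V} {f r : Setoid V} (h : CleanExt M A Q T' f r)
    (hT : T ⊆ T') : CleanExt M A Q T f r :=
  ⟨h.1, fun z hz => h.2.1 z (hT hz), fun x hx y hy => h.2.2 x (hT hx) y (hT hy)⟩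

theorem CleanExt.congr {A Q T : Finset V} {f f' r : Setoid V} (h : CleanExt M A Q T f r)
    (hf : ∀ x ∈ Q \ A, ∀ y ∈ Q \ A, (f x y ↔ f' x y)) : CleanExt M A Q T f' r :=
  ⟨fun x hx y hy => (h.1 x hx y hy).trans (hf x hx y hy), h.2⟩

theorem card_image_le_card_image {ι β γ : Type*} [DecidableEq β] [DecidableEq γ]
    {s : Finset ι} {f : ι → β} {g : ι → γ}
    (h : ∀ x ∈ s, ∀ y ∈ s, g x = g y → f x = f y) : (s.image f).card ≤ (s.image g).card := by
  obtain ⟨u, hus, hu⟩ := Set.exists_subset_bijOn (s : Set ι) f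
  lift u to Finset ι using s.finite_toSet.subset hus
  have himg : s.image f = u.image f := by
    rw [← Finset.coe_inj, Finset.coe_image, Finset.coe_image, hu.image_eq]
  have hg : Set.InjOn g u := fun x hx y hy hxy => hu.injOn hx hy (h x (hus hx) y (hus hy) hxy)
  rw [himg, Finset.card_image_of_injOn hu.injOn, ← Finset.card_image_of_injOn hg]
  exact Finset.card_le_card (Finset.image_subset_image (Finset.coe_subset.1 hus))

/-- Hence a relation of nonnegative weight on `Q` has no clean extension to a set on which all
weights are negative. -/
theorem CleanExt.weight_le (hα : 0 ≤ α) {A Q T : Finset V} {f r : Setoid V} (hAQ : A ⊆ Q)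
    (hQT : Q ⊆ T) (h : CleanExt M A Q T f r) : weight α M A Q f ≤ weight α M A T r := by
  have hv : classCount A Q f ≤ classCount A Q r := by
    unfold classCount
    exact card_image_le_card_image fun x hx y hy hxy =>
      Quotient.sound ((h.1 x hx y hy).1 (Quotient.exact hxy))
  refine weight_le_weight hα (hv.trans (classCount_mono hQT r)) fun e => ?_
  · induction e with | _ x y =>
    simp only [mk_mem_longEdges]
    rintro ⟨hx, hy, hxy, h1, h2⟩
    have key : ∀ x y, x ∈ T → y ∈ T → M.Adj x y → ¬ (x ∉ A ∧ y ∉ A ∧ r x y) → x ∈ Q := by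
      intro x y hx hy hxy hr
      by_contra hxQ
      exact hr ⟨fun hA => hxQ (hAQ hA), h.2.2 x hx y hy hxy hxQ⟩
    have hxQ := key x y hx hy hxy h2
    have hyQ := key y x hy hx hxy.symm fun h => h2 ⟨h.2.1, h.1, r.symm' h.2.2⟩
    refine ⟨hxQ, hyQ, hxy, h1, fun h' => h2 ⟨h'.1, h'.2.1, ?_⟩⟩
    exact (h.1 x (by simp [hxQ, h'.1]) y (by simp [hyQ, h'.2.1])).2 h'.2.2

/-- The weight drops by a definite amount along extensions which are not clean. -/
theorem weight_le_sub_of_not_cleanExt {δ : ℝ} (hδ : 0 ≤ δ) (hδα : δ ≤ α) {k : ℕ}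
    (hk : ∀ v ≤ k, ∀ e : ℕ, (v : ℝ) - α * e < 0 → (v : ℝ) - (α - δ) * e ≤ 0)
    {A Q T : Finset V} {r : Setoid V} (hAQ : A ⊆ Q) (hQT : Q ⊆ T)
    (hC : ∀ z ∈ T \ Q, ∃ C ⊆ T, z ∈ C ∧ C.card ≤ k ∧ LEi α M (C ∩ Q) C)
    (hr : ¬ CleanExt M A Q T r r) : weight α M A T r ≤ weight α M A Q r - δ := by
  have hw := weight_le_of_cover (sub_nonneg.2 hδα) hk r _ Q rfl hAQ hQT hC
  have hsub := longEdges_mono (M := M) (A := A) hQT r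
  -- Without new long edges the class count cannot grow either, and the extension would be clean.
  have hne : longEdges M A Q r ≠ longEdges M A T r := by
    intro heq
    have hv : classCount A T r ≤ classCount A Q r := by
      unfold weight at hw
      rw [heq] at hw
      have : (classCount A T r : ℝ) ≤ classCount A Q r := by linarith
      exact_mod_cast this
    have himg := Finset.eq_of_subset_of_card_le (Finset.image_subset_image (f := Quotient.mk r)
      (Finset.sdiff_subset_sdiff hQT (subset_refl A))) hv
    refine hr ⟨fun _ _ _ _ => Iff.rfl, fun z hz hzA => ?_, fun x hx y hy hxy hxQ => ?_⟩
    · have hz' : Quotient.mk r z ∈ (T \ A).image (Quotient.mk r) :=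
        Finset.mem_image_of_mem _ (Finset.mem_sdiff.2 ⟨hz, hzA⟩)
      rw [← himg] at hz'
      obtain ⟨q, hq, hqz⟩ := Finset.mem_image.1 hz'
      exact ⟨q, hq, r.symm' (Quotient.exact hqz)⟩
    · have hnot : s(x, y) ∉ longEdges M A T r := by
        rw [← heq, mk_mem_longEdges]
        tauto
      rw [mk_mem_longEdges] at hnot
      have := fun h => hxQ (@hAQ x h)
      tauto
  have hlt : (longEdges M A Q r).card + 1 ≤ (longEdges M A T r).card :=
    Finset.card_lt_card (hsub.ssubset_of_ne hne)
  have hlt' : ((longEdges M A Q r).card : ℝ) + 1 ≤ (longEdges M A T r).card := by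
    exact_mod_cast hlt
  have := mul_le_mul_of_nonneg_left hlt' hδ
  unfold weight at hw ⊢
  linarith

/-- Clean extensions are unique on sets `C` with `C ∩ Q ≤*_i C`. -/
theorem CleanExt.unique {A Q T C : Finset V} {f r r' : Setoid V}
    (hCT : C ⊆ T)
    (hC : LEi α M (C ∩ Q) C) (hr : CleanExt M A Q T f r) (hr' : CleanExt M A Q T f r') :
    ∀ z ∈ C, z ∉ A → ∀ q ∈ Q \ A, (r z q ↔ r' z q) := by
  have hQ : ∀ z ∈ Q, z ∉ A → ∀ q ∈ Q \ A, (r z q ↔ r' z q) := fun z hz hzA q hq =>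
    (hr.1 z (Finset.mem_sdiff.2 ⟨hz, hzA⟩) q hq).trans
      (hr'.1 z (Finset.mem_sdiff.2 ⟨hz, hzA⟩) q hq).symm
  by_contra hcon
  push Not at hcon
  obtain ⟨z₀, hz₀C, hz₀A, hz₀⟩ := hcon
  -- `P` is where the two relations agree. An edge from `C \ P` to `P` joins equivalent vertices in
  -- both relations, so agreement spreads along it.
  set P := C.filter fun z => z ∉ A → ∀ q ∈ Q \ A, (r z q ↔ r' z q) with hP
  have hne : P ≠ C := by
    intro h
    rw [← h, hP, Finset.mem_filter] at hz₀C
    obtain ⟨q, hq, hq'⟩ := hz₀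
    have := hz₀C.2 hz₀A q hq
    tauto
  have hsub : C ∩ Q ⊆ P := fun z hz => by
    rw [Finset.mem_inter] at hz
    exact Finset.mem_filter.2 ⟨hz.1, hQ z hz.2⟩
  obtain ⟨x, hx, y, hy, hxy⟩ :=
    ((hC.mono_base hsub (Finset.filter_subset _ _)).ltc hne).exists_adj
  rw [Finset.mem_sdiff] at hx
  have hxQ : x ∉ Q := fun h => hx.2 (hsub (Finset.mem_inter.2 ⟨hx.1, h⟩))
  have hyC := Finset.mem_filter.1 hy
  obtain ⟨hyA, hr1⟩ := hr.2.2 x (hCT hx.1) y (hCT hyC.1) hxy hxQ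
  obtain ⟨-, hr2⟩ := hr'.2.2 x (hCT hx.1) y (hCT hyC.1) hxy hxQ
  refine hx.2 (Finset.mem_filter.2 ⟨hx.1, fun _ q hq => ?_⟩)
  have := hyC.2 hyA q hq
  exact ⟨fun h => r'.trans' hr2 (this.1 (r.trans' (r.symm' hr1) h)),
    fun h => r.trans' hr1 (this.2 (r'.trans' (r'.symm' hr2) h))⟩

/-- Clean extensions to all `Q ∪ C y ∪ C y'` glue to a clean extension to `D`. -/
theorem exists_cleanExt_of_pairs {A Q D : Finset V} {f : Setoid V} (hAQ : A ⊆ Q)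
    (C : V → Finset V) (hC : ∀ y ∈ D, y ∉ Q → y ∈ C y ∧ LEi α M (C y ∩ Q) (C y))
    (hpair : ∀ y ∈ D, y ∉ Q → ∀ y' ∈ D, y' ∉ Q →
      ∃ r, CleanExt M A Q (Q ∪ (C y ∪ C y')) f r) :
    ∃ r, CleanExt M A Q D f r := by
  have hself : ∀ y, ∃ r, y ∈ D → y ∉ Q → CleanExt M A Q (Q ∪ C y) f r := by
    intro y
    by_cases h : y ∈ D ∧ y ∉ Q
    · obtain ⟨r, hr⟩ := hpair y h.1 h.2 y h.1 h.2
      exact ⟨r, fun _ _ => by simpa using hr⟩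
    · exact ⟨⊤, fun h1 h2 => absurd ⟨h1, h2⟩ h⟩
  choose g hg using hself
  -- `N y` is the trace on `Q \ A` of the class of `y`. By uniqueness any clean extension containing
  -- `C y` computes it; the glued relation is equality of traces.
  let N : V → Set V := fun y => {q | q ∈ Q \ A ∧ if y ∈ Q then f y q else g y y q}
  have key : ∀ y ∈ D, y ∉ A → ∀ T, Q ⊆ T → (y ∉ Q → C y ⊆ T) → ∀ r, CleanExt M A Q T f r →
      N y = {q | q ∈ Q \ A ∧ r y q} := by
    intro y hyD hyA T hQT hCT r hr
    ext q
    simp only [N, Set.mem_ofPred_eq]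
    refine and_congr_right fun hq => ?_
    by_cases hyQ : y ∈ Q
    · rw [if_pos hyQ]
      exact (hr.1 y (Finset.mem_sdiff.2 ⟨hyQ, hyA⟩) q hq).symm
    · rw [if_neg hyQ]
      exact (hg y hyD hyQ).unique Finset.subset_union_right
        (hC y hyD hyQ).2 (hr.mono (Finset.union_subset hQT (hCT hyQ))) y (hC y hyD hyQ).1 hyA q hq
  have hNQ : ∀ y ∈ Q, N y = {q | q ∈ Q \ A ∧ f y q} := by
    intro y hy
    ext q
    simp only [N, Set.mem_ofPred_eq, if_pos hy]
  have hrel : ∀ (r : Setoid V) (x y : V), r x y →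
      {q | q ∈ Q \ A ∧ r x q} = {q | q ∈ Q \ A ∧ r y q} := by
    intro r x y hxy
    ext q
    exact and_congr_right fun _ => ⟨fun h => r.trans' (r.symm' hxy) h, fun h => r.trans' hxy h⟩
  refine ⟨Setoid.ker N, fun x hx y hy => ?_, fun z hz hzA => ?_, fun x hx y hy hxy hxQ => ?_⟩
  · have hx' := Finset.mem_sdiff.1 hx
    have hy' := Finset.mem_sdiff.1 hy
    rw [Setoid.ker_def, hNQ x hx'.1, hNQ y hy'.1]
    refine ⟨fun h => ?_, hrel f x y⟩
    have : y ∈ {q | q ∈ Q \ A ∧ f y q} := ⟨hy, f.refl' y⟩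
    rw [← h] at this
    exact this.2
  · by_cases hzQ : z ∈ Q
    · exact ⟨z, Finset.mem_sdiff.2 ⟨hzQ, hzA⟩, rfl⟩
    · have hgz := hg z hz hzQ
      obtain ⟨q, hq, hzq⟩ := hgz.2.1 z (Finset.mem_union_right _ (hC z hz hzQ).1) hzA
      refine ⟨q, hq, ?_⟩
      rw [Setoid.ker_def, key z hz hzA _ Finset.subset_union_left
        (fun _ => Finset.subset_union_right) _ hgz, hrel _ _ _ hzq, hNQ q (Finset.mem_sdiff.1 hq).1]
      ext q'
      exact and_congr_right fun hq' => hgz.1 q hq q' hq'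
  · have hxA : x ∉ A := fun h => hxQ (hAQ h)
    have : ∃ T r, Q ⊆ T ∧ C x ⊆ T ∧ y ∈ T ∧ (y ∉ Q → C y ⊆ T) ∧ CleanExt M A Q T f r := by
      by_cases hyQ : y ∈ Q
      · exact ⟨Q ∪ C x, g x, Finset.subset_union_left, Finset.subset_union_right,
          Finset.mem_union_left _ hyQ, fun h => absurd hyQ h, hg x hx hxQ⟩
      · obtain ⟨r, hr⟩ := hpair x hx hxQ y hy hyQ
        refine ⟨_, r, Finset.subset_union_left,
          Finset.subset_union_left.trans Finset.subset_union_right, ?_,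
          fun _ => Finset.subset_union_right.trans Finset.subset_union_right, hr⟩
        exact Finset.mem_union_right _ (Finset.mem_union_right _ (hC y hy hyQ).1)
    obtain ⟨T, r, hQT, hxT, hyT, hyT', hr⟩ := this
    obtain ⟨hyA, hrxy⟩ := hr.2.2 x (hxT (hC x hx hxQ).1) y hyT hxy hxQ
    refine ⟨hyA, ?_⟩
    rw [Setoid.ker_def, key x hx hxA T hQT (fun _ => hxT) r hr, key y hy hyA T hQT hyT' r hr]
    exact hrel _ _ _ hrxy

/-- One refinement step: a bounded enlargement of `Q` on which all nonnegative weights drop. -/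
theorem exists_weight_drop (hα : 0 ≤ α) {δ : ℝ} (hδ : 0 ≤ δ) (hδα : δ ≤ α) {k : ℕ}
    (hk : ∀ v ≤ k, ∀ e : ℕ, (v : ℝ) - α * e < 0 → (v : ℝ) - (α - δ) * e ≤ 0)
    {A Q D : Finset V} (hAQ : A ⊆ Q) (hQD : Q ⊆ D)
    (hC : ∀ z ∈ D, z ∉ Q → ∃ C ⊆ D, z ∈ C ∧ C.card ≤ k ∧ LEi α M (C ∩ Q) C)
    (hD : ∀ r, weight α M A D r < 0) {n : ℕ} (hn : (Q \ A).card ≤ n) :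
    ∃ T, Q ⊆ T ∧ T ⊆ D ∧ (T \ A).card ≤ n + 2 ^ (n * n) * (2 * k) ∧
      ∀ r, weight α M A T r < 0 ∨ weight α M A T r ≤ weight α M A Q r - δ := by
  have hC' : ∀ z, ∃ C : Finset V, z ∈ D → z ∉ Q →
      C ⊆ D ∧ z ∈ C ∧ C.card ≤ k ∧ LEi α M (C ∩ Q) C := by
    intro z
    by_cases h : z ∈ D ∧ z ∉ Q
    · obtain ⟨C, hC⟩ := hC z h.1 h.2
      exact ⟨C, fun _ _ => hC⟩
    · exact ⟨∅, fun h1 h2 => absurd ⟨h1, h2⟩ h⟩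
  choose C hC using hC'
  -- Only the restriction of a relation to `Q \ A` matters, so at most `2 ^ (n * n)` cases need a
  -- witness.
  let graph : Setoid V → Finset (V × V) := fun f =>
    ((Q \ A) ×ˢ (Q \ A)).filter fun p => f p.1 p.2
  have hgraph : ∀ f f', graph f = graph f' → ∀ x ∈ Q \ A, ∀ y ∈ Q \ A, (f x y ↔ f' x y) := by
    intro f f' h x hx y hy
    have : (x, y) ∈ graph f ↔ (x, y) ∈ graph f' := by rw [h]
    simp only [graph, Finset.mem_filter, Finset.mem_product] at this
    tauto
  have hE : ∀ R : Finset (V × V), ∃ E ⊆ D, E.card ≤ 2 * k ∧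
      (∀ z ∈ E, z ∉ Q → ∃ C ⊆ E, z ∈ C ∧ C.card ≤ k ∧ LEi α M (C ∩ Q) C) ∧
      ∀ f, graph f = R → 0 ≤ weight α M A Q f → ∀ r, ¬ CleanExt M A Q (Q ∪ E) f r := by
    intro R
    by_cases hR : ∃ f, graph f = R ∧ 0 ≤ weight α M A Q f
    · obtain ⟨f, hfR, hfw⟩ := hR
      have hno : ¬ ∃ r, CleanExt M A Q D f r := by
        rintro ⟨r, hr⟩
        have := hr.weight_le hα hAQ hQD
        have := hD r
        linarith
      -- By gluing, the absence of a clean extension is already visible on two of the sets `C y`.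
      have hno' : ¬ ∀ y ∈ D, y ∉ Q → ∀ y' ∈ D, y' ∉ Q →
          ∃ r, CleanExt M A Q (Q ∪ (C y ∪ C y')) f r := fun h =>
        hno (exists_cleanExt_of_pairs hAQ C
          (fun y hy hyQ => ⟨(hC y hy hyQ).2.1, (hC y hy hyQ).2.2.2⟩) h)
      push Not at hno'
      obtain ⟨y, hy, hyQ, y', hy', hyQ', hyy⟩ := hno'
      obtain ⟨h1, h2, h3, h4⟩ := hC y hy hyQ
      obtain ⟨h1', h2', h3', h4'⟩ := hC y' hy' hyQ'
      refine ⟨C y ∪ C y', Finset.union_subset h1 h1', ?_, ?_, ?_⟩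
      · exact (Finset.card_union_le _ _).trans (by omega)
      · intro z hz hzQ
        rcases Finset.mem_union.1 hz with hz | hz
        · exact ⟨_, Finset.subset_union_left, hz, h3, h4⟩
        · exact ⟨_, Finset.subset_union_right, hz, h3', h4'⟩
      · intro f' hf' _ r hr
        exact hyy r (hr.congr (hgraph f' f (hf'.trans hfR.symm)))
    · exact ⟨∅, Finset.empty_subset _, by simp, by simp, fun f h1 h2 => absurd ⟨f, h1, h2⟩ hR⟩
  choose E hED hEk hEC hE using hE
  set T := Q ∪ ((Q \ A) ×ˢ (Q \ A)).powerset.biUnion E with hT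
  have hQT : Q ⊆ T := Finset.subset_union_left
  have hcov : ∀ z ∈ T \ Q, ∃ C ⊆ T, z ∈ C ∧ C.card ≤ k ∧ LEi α M (C ∩ Q) C := by
    intro z hz
    rw [Finset.mem_sdiff] at hz
    obtain ⟨R, hR, hzR⟩ := Finset.mem_biUnion.1 ((Finset.mem_union.1 hz.1).resolve_left hz.2)
    obtain ⟨C, h1, h2⟩ := hEC R z hzR hz.2
    exact ⟨C, (h1.trans (Finset.subset_biUnion_of_mem E hR)).trans Finset.subset_union_right, h2⟩
  refine ⟨T, hQT, Finset.union_subset hQD (Finset.biUnion_subset.2 fun R _ => hED R), ?_, ?_⟩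
  · have h1 : T \ A ⊆ (Q \ A) ∪ ((Q \ A) ×ˢ (Q \ A)).powerset.biUnion E := by
      intro x hx
      simp only [hT, Finset.mem_sdiff, Finset.mem_union] at hx ⊢
      tauto
    refine (Finset.card_le_card h1).trans ((Finset.card_union_le _ _).trans (add_le_add hn ?_))
    refine (Finset.card_biUnion_le_card_mul _ _ _ fun R _ => hEk R).trans ?_
    refine Nat.mul_le_mul_right _ ?_
    rw [Finset.card_powerset, Finset.card_product]
    exact Nat.pow_le_pow_right (by norm_num) (Nat.mul_le_mul hn hn)
  · intro r
    by_cases hr : weight α M A Q r < 0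
    · left
      exact (weight_le_of_cover hα (fun _ _ _ h => h.le) r _ Q rfl hAQ hQT hcov).trans_lt hr
    · right
      refine weight_le_sub_of_not_cleanExt hδ hδα hk hAQ hQT hcov fun hcl => ?_
      refine hE (graph r) r rfl (not_lt.1 hr) r (hcl.mono (Finset.union_subset hQT ?_))
      exact (Finset.subset_biUnion_of_mem E (Finset.mem_powerset.2
        (Finset.filter_subset _ _))).trans Finset.subset_union_right

end CleanExtension

/-- If `A <*_c D`, where `D` is generated over `A` and boundedly many further vertices by sets of
bounded size, then already `A <*_c D₀` for some `D₀ ⊆ D` with `|D₀ \ A|` bounded. -/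
theorem exists_bounded_ltc.{u} {α : ℝ} (hα : 0 ≤ α) {δ : ℝ} (hδ : 0 < δ) (hδα : δ ≤ α) {k : ℕ}
    (hk : ∀ v ≤ k, ∀ e : ℕ, (v : ℝ) - α * e < 0 → (v : ℝ) - (α - δ) * e ≤ 0) (p : ℕ) :
    ∃ N : ℕ, ∀ (V : Type u) (M : SimpleGraph V) (A D S : Finset V), S ⊆ D →
      S.card ≤ p →
      (∀ z ∈ D, z ∉ A → z ∉ S → ∃ C ⊆ D, z ∈ C ∧ C.card ≤ k ∧ LEi α M (C ∩ (A ∪ S)) C) →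
      LTc α M A D → ∃ D₀, D₀ ⊆ D ∧ (D₀ \ A).card ≤ N ∧ LTc α M A D₀ := by
  -- `n i` bounds `|Q \ A|` after `i` refinements. Weights start at most `p` and each nonnegative
  -- one drops by `δ` per round, so `i > p / δ` rounds suffice.
  let n : ℕ → ℕ := fun i => Nat.rec p (fun _ n => n + 2 ^ (n * n) * (2 * k)) i
  obtain ⟨i, hi⟩ := exists_nat_gt ((p : ℝ) / δ)
  refine ⟨n i, fun V M A D S hSD hSp hC hAD => ?_⟩
  have main : ∀ i, ∃ Q, A ∪ S ⊆ Q ∧ Q ⊆ D ∧ (Q \ A).card ≤ n i ∧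
      ∀ r, weight α M A Q r < 0 ∨ weight α M A Q r ≤ p - i * δ := by
    intro i
    induction i with
    | zero =>
      have hcard : ((A ∪ S) \ A).card ≤ p := by
        refine (Finset.card_le_card fun x hx => ?_).trans hSp
        simp only [Finset.mem_sdiff, Finset.mem_union] at hx
        tauto
      refine ⟨A ∪ S, subset_rfl, Finset.union_subset hAD.1.1 hSD, hcard, fun r => Or.inr ?_⟩
      have h1 : (classCount A (A ∪ S) r : ℝ) ≤ p := by
        exact_mod_cast (classCount_le_card _ _ r).trans hcard
      have h2 : 0 ≤ α * ((longEdges M A (A ∪ S) r).card : ℝ) := by positivity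
      unfold weight
      push_cast
      linarith
    | succ i ih =>
      obtain ⟨Q, h1, h2, h3, h4⟩ := ih
      have hAQ : A ⊆ Q := Finset.subset_union_left.trans h1
      obtain ⟨T, h5, h6, h7, h8⟩ := exists_weight_drop hα hδ.le hδα hk hAQ h2 (fun z hz hzQ => by
        obtain ⟨C, hCD, hzC, hCk, hCi⟩ := hC z hz (fun h => hzQ (hAQ h))
          (fun h => hzQ (h1 (Finset.mem_union_right _ h)))
        exact ⟨C, hCD, hzC, hCk, hCi.mono_base (Finset.inter_subset_inter subset_rfl h1)
          Finset.inter_subset_left⟩) hAD.2 h3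
      refine ⟨T, h1.trans h5, h6, h7, fun r => ?_⟩
      rcases h8 r with h | h
      · exact Or.inl h
      · rcases h4 r with h' | h'
        · exact Or.inl (by linarith)
        · right
          push_cast
          linarith
  obtain ⟨Q, h1, h2, h3, h4⟩ := main i
  have hlt : ∀ r, weight α M A Q r < 0 := by
    intro r
    rcases h4 r with h | h
    · exact h
    · rw [div_lt_iff₀ hδ] at hi
      linarith
  refine ⟨Q, h2, h3, (Finset.subset_union_left.trans h1).ssubset_of_ne ?_, hlt⟩
  rintro rfl
  have := hlt ⊤
  rw [weight_self] at this
  exact lt_irrefl _ this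

/-! ### Monotonicity of the closure. -/

section Closure

variable {V : Type*} {M : SimpleGraph V} {α : ℝ} {k : ℕ}

theorem subset_cl (A : Set V) : A ⊆ cl α M k A := Set.subset_union_left

/-- A set `C` of size at most `k` with `P ≤*_i C` for some `P ⊆ A` lies in `cl^k(A)`. -/
theorem subset_cl_of_lei {A : Set V} {P C : Finset V} (h : LEi α M P C) (hP : (P : Set V) ⊆ A)
    (hC : C.card ≤ k) : (C : Set V) ⊆ cl α M k A := by
  intro x hx
  refine Or.inr ⟨C, hC, hx, h.mono_base (fun y hy => ?_) (Finset.filter_subset _ _)⟩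
  exact Finset.mem_filter.2 ⟨h.1 hy, hP hy⟩

theorem exists_of_mem_cl {A : Set V} {x : V} (hx : x ∈ cl α M k A) (hxA : x ∉ A) :
    ∃ C : Finset V, C.card ≤ k ∧ x ∈ C ∧ (C : Set V) ⊆ cl α M k A ∧
      LEi α M (C.filter fun y => y ∈ A) C := by
  obtain ⟨C, h1, h2, h3⟩ := hx.resolve_left hxA
  exact ⟨C, h1, h2, fun y hy => Or.inr ⟨C, h1, hy, h3⟩, h3⟩

theorem cl_mono {k' : ℕ} (hk : k ≤ k') {A A' : Set V} (h : A ⊆ A') :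
    cl α M k A ⊆ cl α M k' A' := by
  rintro x (hx | ⟨C, h1, h2, h3⟩)
  · exact Or.inl (h hx)
  · refine subset_cl_of_lei h3 ?_ (h1.trans hk) h2
    intro y hy
    exact h (Finset.mem_filter.1 hy).2

theorem clIter_mono {A : Set V} {i j : ℕ} (h : i ≤ j) : clIter α M k i A ⊆ clIter α M k j A :=
  monotone_nat_of_le_succ (f := fun i => clIter α M k i A) (fun _ => subset_cl _) h

end Closure

/-! ### A pigeonhole over dyadic scales. -/

/-- Given two-parameter counters `e` and `u` with few jumps, there are three points at equal
distance `d ≥ s` such that `e` does not jump between the first two and `u` does not jump between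
the last two. -/
theorem exists_stable_scale (c k s : ℕ) (hs : 1 ≤ s) :
    ∃ L : ℕ, ∀ e u : ℕ → ℕ → ℕ, (∀ i g, i < g → g ≤ L → e i g ≤ c) →
      (∀ i j g, i ≤ j → j < g → g ≤ L → e i g ≤ e j g) →
      (∀ i j, u i j ≤ k) → (∀ i j j', j ≤ j' → u i j ≤ u i j') →
      ∃ i d, s ≤ d ∧ i + 2 * d ≤ L ∧ e i (i + 2 * d) = e (i + d) (i + 2 * d) ∧
        u i (i + d) = u i (i + 2 * d) := by
  set R := 2 * c + k + 1 with hR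
  set d : ℕ → ℕ := fun r => s * 2 ^ r with hd
  have hd1 : ∀ r, s ≤ d r := fun r => Nat.le_mul_of_pos_right s (by positivity)
  have hdsucc : ∀ r, d (r + 1) = 2 * d r := fun r => by simp only [hd]; ring
  have hdmono : Monotone d := monotone_nat_of_le_succ fun r => by rw [hdsucc]; omega
  set L := d R with hL
  have hLpos : 1 ≤ L := hs.trans (hd1 R)
  refine ⟨2 * L, fun e u he hemono hu humono => ?_⟩
  by_contra! hno
  -- If every scale fails, each pair `(i, r)` contributes at least 1 to the sum of `h` and `w`. Over
  -- `r`, `w` telescopes to at most `k` for fixed `i`, and `h` to at most `c` for fixed `g`. The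
  -- total `L * R` is then at most `L * k + 2 * L * c`, too little for the chosen `R`. Truncated
  -- subtraction only replaces negative stages by 0.
  let h : ℕ → ℕ → ℤ := fun r g => (e (g - d r) g : ℤ) - e (g - d (r + 1)) g
  let w : ℕ → ℕ → ℤ := fun i r => (u i (i + d (r + 1)) : ℤ) - u i (i + d r)
  have hpos : ∀ r g, 1 ≤ g → g ≤ 2 * L → 0 ≤ h r g := by
    intro r g hg hgL
    have h1 := hd1 r
    have h2 := hemono (g - d (r + 1)) (g - d r) g (by rw [hdsucc]; omega) (by omega) hgL
    simp only [h]
    omega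
  have hone : ∀ i ∈ Finset.range L, ∀ r ∈ Finset.range R, 1 ≤ h r (i + d (r + 1)) + w i r := by
    intro i hi r hr
    rw [Finset.mem_range] at hi hr
    have h1 := hd1 r
    have h2 : d (r + 1) ≤ L := hdmono (by omega)
    rw [hdsucc] at h2
    have h3 := hno i (d r) h1 (by omega)
    have h4 := hemono i (i + d r) (i + 2 * d r) (by omega) (by omega) (by omega)
    have h5 := humono i (i + d r) (i + 2 * d r) (by omega)
    simp only [h, w, hdsucc]
    have e1 : i + 2 * d r - d r = i + d r := by omega
    have e2 : i + 2 * d r - 2 * d r = i := by omega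
    rw [e1, e2]
    by_cases h6 : e i (i + 2 * d r) = e (i + d r) (i + 2 * d r)
    · have := h3 h6
      omega
    · omega
  have hsum : (L * R : ℤ) ≤
      ∑ i ∈ Finset.range L, ∑ r ∈ Finset.range R, (h r (i + d (r + 1)) + w i r) := by
    calc (L * R : ℤ) = ∑ i ∈ Finset.range L, ∑ r ∈ Finset.range R, (1 : ℤ) := by simp
      _ ≤ _ := Finset.sum_le_sum fun i hi => Finset.sum_le_sum fun r hr => hone i hi r hr
  have hw : ∑ i ∈ Finset.range L, ∑ r ∈ Finset.range R, w i r ≤ L * k := by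
    calc _ ≤ ∑ i ∈ Finset.range L, (k : ℤ) := Finset.sum_le_sum fun i _ => by
            simp only [w]
            rw [Finset.sum_range_sub fun r => (u i (i + d r) : ℤ)]
            have := hu i (i + d R)
            omega
      _ = L * k := by simp
  have hh : ∑ i ∈ Finset.range L, ∑ r ∈ Finset.range R, h r (i + d (r + 1)) ≤ 2 * L * c := by
    rw [Finset.sum_comm]
    calc _ ≤ ∑ r ∈ Finset.range R, ∑ g ∈ Finset.Ico 1 (2 * L + 1), h r g := by
            refine Finset.sum_le_sum fun r hr => ?_
            rw [Finset.mem_range] at hr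
            have hinj : Set.InjOn (fun i => i + d (r + 1)) (Finset.range L) :=
              fun a _ b _ hab => by simpa using hab
            rw [← Finset.sum_image (f := fun g => h r g) hinj]
            refine Finset.sum_le_sum_of_subset_of_nonneg (fun g hg => ?_) fun g hg _ => ?_
            · obtain ⟨i, hi, rfl⟩ := Finset.mem_image.1 hg
              rw [Finset.mem_range] at hi
              have h1 := hd1 (r + 1)
              have h2 : d (r + 1) ≤ L := hdmono (by omega)
              exact Finset.mem_Ico.2 ⟨by omega, by omega⟩
            · rw [Finset.mem_Ico] at hg
              exact hpos r g hg.1 (by omega)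
      _ = ∑ g ∈ Finset.Ico 1 (2 * L + 1), ∑ r ∈ Finset.range R, h r g := Finset.sum_comm
      _ ≤ ∑ g ∈ Finset.Ico 1 (2 * L + 1), (c : ℤ) := Finset.sum_le_sum fun g hg => by
            rw [Finset.mem_Ico] at hg
            have h0 := hd1 0
            have := he (g - d 0) g (by omega) (by omega)
            have h2 : ∑ r ∈ Finset.range R, h r g =
                (e (g - d 0) g : ℤ) - e (g - d R) g := by
              have := Finset.sum_range_sub' (fun r => (e (g - d r) g : ℤ)) R
              simpa [h] using this
            rw [h2]
            omega
      _ = 2 * L * c := by simp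
  simp only [Finset.sum_add_distrib] at hsum
  have hfin : (L * R : ℤ) ≤ L * (2 * c + k) := by linarith
  have := le_of_mul_le_mul_left hfin (by exact_mod_cast hLpos)
  rw [hR] at this
  push_cast at this
  linarith

/-! ### Edges leaving the iterated closure, and a stable stage. -/

section Crossing

variable {V : Type*} {M : SimpleGraph V} {α δ : ℝ} {k K ℓ c : ℕ}

/-- The edges from `cl^{K,i}(s)` to `cl^k(sb) \ cl^{K,g}(s)`, as ordered pairs. -/
def crossing (α : ℝ) (M : SimpleGraph V) (k K : ℕ) (s : Finset V) (b : V) (i g : ℕ) :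
    Set (V × V) :=
  {p | p.1 ∈ clIter α M K i (s : Set V) ∧ p.2 ∈ cl α M k (insert b (s : Set V)) ∧
    p.2 ∉ clIter α M K g (s : Set V) ∧ M.Adj p.1 p.2}

theorem crossing_mono {s : Finset V} {b : V} {i j g : ℕ} (h : i ≤ j) :
    crossing α M k K s b i g ⊆ crossing α M k K s b j g :=
  fun _ hp => ⟨clIter_mono h hp.1, hp.2⟩

/-- A choice of witnesses for membership in a closure. -/
theorem exists_cover (α : ℝ) (M : SimpleGraph V) (k : ℕ) (A : Set V) :
    ∃ C : V → Finset V, ∀ z, (z ∈ cl α M k A → z ∉ A → z ∈ C z) ∧ (C z).card ≤ k ∧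
      ((C z : Finset V) : Set V) ⊆ cl α M k A ∧ ∃ P : Finset V, (P : Set V) ⊆ A ∧ LEi α M P (C z) := by
  have : ∀ z, ∃ C : Finset V, (z ∈ cl α M k A → z ∉ A → z ∈ C) ∧ C.card ≤ k ∧
      (C : Set V) ⊆ cl α M k A ∧ ∃ P : Finset V, (P : Set V) ⊆ A ∧ LEi α M P C := by
    intro z
    by_cases h : z ∈ cl α M k A ∧ z ∉ A
    · obtain ⟨C, h1, h2, h3⟩ := exists_of_mem_cl h.1 h.2
      exact ⟨C, fun _ _ => h2, h1, h3.1, _, fun x hx => (Finset.mem_filter.1 hx).2, h3.2⟩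
    · exact ⟨∅, fun h1 h2 => absurd ⟨h1, h2⟩ h, by simp, by simp, ∅, by simp, LEi.refl _⟩
  exact ⟨fun z => (this z).choose, fun z => (this z).choose_spec⟩

theorem le_of_mul_le_one (hδ : 0 < δ) (hc : 1 < δ * (c + 1)) {n : ℕ} (hn : δ * n ≤ 1) : n ≤ c := by
  by_contra! h
  have : (c : ℝ) + 1 ≤ n := by exact_mod_cast h
  have := mul_le_mul_of_nonneg_left this hδ.le
  linarith

/-- Put `c + 1` such edges, with `s`, `b` and witnesses for the outer endpoints, into a set `D` of
size at most `K`. A maximal `≤*_i`-extension `E` of the part of `D` in stage `i` lies in stage `i +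
1`, so it misses `b`. Some weight of `D` over `E` is therefore nonnegative, yet all `c + 1` edges
are long. -/
theorem crossing_finite (hα : 0 ≤ α) (hδ : 0 < δ) (hδα : δ ≤ α)
    (hk : ∀ v ≤ k, ∀ e : ℕ, (v : ℝ) - α * e < 0 → (v : ℝ) - (α - δ) * e ≤ 0)
    (hc : 1 < δ * (c + 1)) (hK : ℓ + 1 + (c + 1) * (k + 1) ≤ K) {s : Finset V} (hs : s.card ≤ ℓ)
    {b : V} {i g : ℕ} (hig : i < g) (hb : b ∉ clIter α M K g (s : Set V)) :
    (crossing α M k K s b i g).Finite ∧ (crossing α M k K s b i g).ncard ≤ c := by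
  rw [← Set.encard_le_coe_iff_finite_ncard_le]
  by_contra! hlt
  obtain ⟨t', ht', htc⟩ := Set.exists_subset_encard_eq (Order.add_one_le_of_lt hlt)
  have hfin : t'.Finite := Set.finite_of_encard_eq_coe (k := c + 1) (by rw [htc]; norm_cast)
  lift t' to Finset (V × V) using hfin
  rename' t' => t
  rw [Set.encard_coe_eq_coe_finsetCard] at htc
  have htc : t.card = c + 1 := by exact_mod_cast htc
  obtain ⟨C, hC⟩ := exists_cover α M k (insert b (s : Set V))
  set X := clIter α M K i (s : Set V) with hX
  set D := insert b (s ∪ t.image Prod.fst ∪ t.biUnion fun p => C p.2) with hD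
  have hbD : b ∈ D := Finset.mem_insert_self _ _
  have hDK : D.card ≤ K := by
    have h1 : (t.image Prod.fst).card ≤ c + 1 := Finset.card_image_le.trans htc.le
    have h2 : (t.biUnion fun p => C p.2).card ≤ (c + 1) * k :=
      (Finset.card_biUnion_le_card_mul _ _ _ fun p _ => (hC p.2).2.1).trans (by rw [htc])
    have h3 : D.card ≤ _ := Finset.card_insert_le b _
    have h4 := Finset.card_union_le (s ∪ t.image Prod.fst) (t.biUnion fun p => C p.2)
    have h5 := Finset.card_union_le s (t.image Prod.fst)
    have h6 : (c + 1) * (k + 1) = (c + 1) * k + (c + 1) := by ring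
    omega
  have hCD : ∀ p ∈ t, C p.2 ⊆ D := fun p hp =>
    (Finset.subset_biUnion_of_mem (fun p => C p.2) hp).trans
      (Finset.subset_union_right.trans (Finset.subset_insert _ _))
  obtain ⟨E, hAE, hED, hE, hEw⟩ := exists_maximal_lei (M := M) hα
    (LEi.refl (D.filter fun x => x ∈ X)) (Finset.filter_subset _ D)
  have hEX : (E : Set V) ⊆ clIter α M K g (s : Set V) :=
    (subset_cl_of_lei hE (fun x hx => (Finset.mem_filter.1 hx).2)
      ((Finset.card_le_card hED).trans hDK)).trans (clIter_mono (i := i + 1) hig)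
  have hbE : b ∉ E := fun h => hb (hEX h)
  obtain ⟨r, hr⟩ := hEw fun h => hbE (h ▸ hbD)
  have hXE : ∀ x ∈ D, x ∈ X → x ∈ E := fun x hx hxX => hAE (Finset.mem_filter.2 ⟨hx, hxX⟩)
  have hsX : ∀ x ∈ s, x ∈ X := fun x hx => clIter_mono (Nat.zero_le i) hx
  have hsE : ∀ x ∈ s, x ∈ E := fun x hx => hXE x (by simp [hD, hx]) (hsX x hx)
  have ht1 : ∀ p ∈ t, p.1 ∈ E := fun p hp => hXE p.1 (by
    simp only [hD, Finset.mem_insert, Finset.mem_union, Finset.mem_image]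
    exact Or.inr (Or.inl (Or.inr ⟨p, hp, rfl⟩))) (ht' hp).1
  have ht2 : ∀ p ∈ t, p.2 ∉ E := fun p hp h => (ht' hp).2.2.1 (hEX h)
  have ht2D : ∀ p ∈ t, p.2 ∈ D := by
    intro p hp
    by_cases h : p.2 = b
    · rw [h]; exact hbD
    · refine hCD p hp ((hC p.2).1 (ht' hp).2.1 ?_)
      rintro (h' | h')
      · exact h h'
      · exact ht2 p hp (hsE _ h')
  have hle := card_longEdges_le hδα hk hED hbD (fun z hz hzE hzb => by
    simp only [hD, Finset.mem_insert, Finset.mem_union, Finset.mem_image, Finset.mem_biUnion] at hz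
    rcases hz with hz | (hz | ⟨p, hp, rfl⟩) | ⟨p, hp, hz⟩
    · exact absurd hz hzb
    · exact absurd (hsE z hz) hzE
    · exact absurd (ht1 p hp) hzE
    · obtain ⟨-, h1, -, P, hP, hPC⟩ := hC p.2
      refine ⟨C p.2, hCD p hp, hz, h1, hPC.mono_base (fun x hx => ?_) Finset.inter_subset_left⟩
      rw [Finset.mem_inter, Finset.mem_insert]
      exact ⟨hPC.1 hx, (hP hx).imp id fun h => hsE x h⟩) hr
  have hcard : t.card ≤ (longEdges M E D r).card := by
    refine Finset.card_le_card_of_injOn (fun p => s(p.1, p.2)) (fun p hp => ?_) ?_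
    · have h1 := ht1 p hp
      have h2 := ht2 p hp
      exact mk_mem_longEdges.2 ⟨hED h1, ht2D p hp, (ht' hp).2.2.2, fun h => h2 h.2,
        fun h => h.1 h1⟩
    · intro p hp q hq hpq
      rcases Sym2.eq_iff.1 hpq with h | h
      · exact Prod.ext h.1 h.2
      · exact absurd (h.1 ▸ ht1 p hp) (ht2 q hq)
  have := le_of_mul_le_one hδ hc hle
  omega

end Crossing

/-- At some stage the whole boundary of `cl^k(sb) \ cl^{K,j}(s)` in `cl^{K,j}(s)` was already
present `m + 1` steps before. -/
theorem exists_stable_boundary.{u} {α δ : ℝ} {k c : ℕ} (hα : 0 ≤ α) (hδ : 0 < δ) (hδα : δ ≤ α)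
    (hk : ∀ v ≤ k, ∀ e : ℕ, (v : ℝ) - α * e < 0 → (v : ℝ) - (α - δ) * e ≤ 0)
    (hc : 1 < δ * (c + 1)) (ℓ m : ℕ) :
    ∃ L : ℕ, ∀ (V : Type u) (M : SimpleGraph V) (K : ℕ), k ≤ K → ℓ + 1 + (c + 1) * (k + 1) ≤ K →
      ∀ s : Finset V, s.card ≤ ℓ → ∀ b ∉ clIter α M K L (s : Set V),
      ∃ i, i + (m + 1) ≤ L ∧ ∀ x y,
        (x, y) ∈ crossing α M k K s b (i + (m + 1)) (i + (m + 1)) →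
        x ∈ clIter α M K i (s : Set V) := by
  obtain ⟨L, hL⟩ := exists_stable_scale c k (m + 1) (by omega)
  refine ⟨L, fun V M K hkK hK s hs b hb => ?_⟩
  by_contra! hno
  have hno' : ∀ i, ∃ p : V × V, i + (m + 1) ≤ L →
      p ∈ crossing α M k K s b (i + (m + 1)) (i + (m + 1)) ∧
        p.1 ∉ clIter α M K i (s : Set V) := by
    intro i
    by_cases hi : i + (m + 1) ≤ L
    · obtain ⟨x, y, h⟩ := hno i hi
      exact ⟨(x, y), fun _ => h⟩
    · exact ⟨(b, b), fun h => absurd h hi⟩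
  choose p hp using hno'
  obtain ⟨C, hC⟩ := exists_cover α M k (insert b (s : Set V))
  have hbg : ∀ g ≤ L, b ∉ clIter α M K g (s : Set V) := fun g hg h => hb (clIter_mono hg h)
  have hfin : ∀ i g, i < g → g ≤ L → (crossing α M k K s b i g).Finite ∧
      (crossing α M k K s b i g).ncard ≤ c := fun i g hig hg =>
    crossing_finite hα hδ hδα hk hc hK hs hig (hbg g hg)
  let X : ℕ → Set V := fun j => clIter α M K j (s : Set V)
  have hX : ∀ {i j}, i ≤ j → X i ⊆ X j := fun h => clIter_mono h
  let U : ℕ → ℕ → Finset V := fun i j => (C (p i).2).filter fun x => x ∈ X j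
  have hU : ∀ i j j', j ≤ j' → U i j ⊆ U i j' := fun i j j' hj =>
    Finset.monotone_filter_right _ fun x _ hx => hX hj hx
  obtain ⟨i, d, hd, hiL, he, hu⟩ := hL (fun i g => (crossing α M k K s b i g).ncard)
    (fun i j => (U i j).card) (fun i g hig hg => (hfin i g hig hg).2)
    (fun i j g hij hjg hg => Set.ncard_le_ncard (crossing_mono hij) (hfin j g hjg hg).1)
    (fun i j => (Finset.card_le_card (Finset.filter_subset _ _)).trans (hC _).2.1)
    (fun i j j' hj => Finset.card_le_card (hU i j j' hj))
  have he' := Set.eq_of_subset_of_ncard_le (crossing_mono (Nat.le_add_right i d)) he.ge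
    (hfin (i + d) (i + 2 * d) (by omega) hiL).1
  have hu' := Finset.eq_of_subset_of_card_le (hU i (i + d) (i + 2 * d) (by omega)) hu.ge
  obtain ⟨⟨hx1, hy1, hy2, hadj⟩, hx2⟩ := hp i (by omega)
  -- Since `C (p i).2` gains nothing between stages `i + d` and `i + 2 * d`, an edge from `U i (i +
  -- d)` to its complement in `C (p i).2` is a crossing edge, hence starts in `X i`. So
  -- `LEi.restrict` applies with base in `X i`.
  have hUX : (U i (i + d) : Set V) ⊆ X (i + 1) := by
    obtain ⟨-, h1, h2, P, hP, hPC⟩ := hC (p i).2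
    refine subset_cl_of_lei (P := (U i (i + d)).filter fun x => x ∈ X i)
      (hPC.restrict hα (Finset.filter_subset _ _) (Finset.filter_subset _ _) (fun x hx => ?_)
        fun x hx y hy hxy => ?_) (fun x hx => (Finset.mem_filter.1 hx).2)
      ((Finset.card_le_card (Finset.filter_subset _ _)).trans (h1.trans hkK))
    · rw [Finset.mem_inter] at hx
      refine Finset.mem_filter.2 ⟨hx.2, ?_⟩
      rcases hP hx.1 with rfl | h
      · exact absurd (Finset.mem_filter.1 hx.2).2 (hbg _ (by omega))
      · exact hX (Nat.zero_le i) h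
    · rw [Finset.mem_sdiff] at hx hy
      have hy' := hy.2
      rw [hu'] at hy'
      have hxy' : (x, y) ∈ crossing α M k K s b (i + d) (i + 2 * d) :=
        ⟨(Finset.mem_filter.1 hx.1).2, h2 hy.1, fun h => hy' (Finset.mem_filter.2 ⟨hy.1, h⟩), hxy⟩
      rw [← he'] at hxy'
      exact hx.2 (Finset.mem_filter.2 ⟨hx.1, hxy'.1⟩)
  have hy3 : (p i).2 ∉ X (i + 2 * d) := by
    intro hy
    by_cases hyb : (p i).2 = b
    · rw [hyb] at hy
      exact hbg _ hiL hy
    · have hyC : (p i).2 ∈ C (p i).2 := by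
        refine (hC _).1 hy1 ?_
        rintro (h | h)
        · exact hyb h
        · exact hy2 (hX (Nat.zero_le _) h)
      have hyU : (p i).2 ∈ U i (i + 2 * d) := Finset.mem_filter.2 ⟨hyC, hy⟩
      rw [← hu'] at hyU
      exact hy2 (hX (by omega) (hUX hyU))
  have hcr : p i ∈ crossing α M k K s b (i + d) (i + 2 * d) :=
    ⟨hX (by omega) hx1, hy1, hy3, hadj⟩
  rw [← he'] at hcr
  exact hx2 hcr.1

/-! ### Strength of the boundary. -/

section Strong

variable {V : Type*} {M : SimpleGraph V} {α δ : ℝ} {k K c : ℕ}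

/-- A set `B` separating `cl^k(sb) \ cl^{K,j}(s)` from the rest of `cl^{K,j}(s)` is strong in it. -/
theorem les_of_boundary_subset (hα : 0 ≤ α) (hδ : 0 < δ) (hδα : δ ≤ α)
    (hk : ∀ v ≤ k, ∀ e : ℕ, (v : ℝ) - α * e < 0 → (v : ℝ) - (α - δ) * e ≤ 0)
    (hc : 1 < δ * (c + 1)) {N : ℕ} (hN : ∀ A D S : Finset V, S ⊆ D → S.card ≤ c + 1 →
      (∀ z ∈ D, z ∉ A → z ∉ S → ∃ C ⊆ D, z ∈ C ∧ C.card ≤ k ∧ LEi α M (C ∩ (A ∪ S)) C) →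
      LTc α M A D → ∃ D₀, D₀ ⊆ D ∧ (D₀ \ A).card ≤ N ∧ LTc α M A D₀)
    {s B : Finset V} {b : V} {i j : ℕ} (hij : i < j) (hsB : s ⊆ B)
    (hBi : (B : Set V) ⊆ clIter α M K i (s : Set V)) (hBK : B.card + N ≤ K)
    (hB : ∀ x y, (x, y) ∈ crossing α M k K s b j j → x ∈ B) :
    LEs α M B (cl α M k (insert b (s : Set V)) \ clIter α M K j (s : Set V) ∪ (B : Set V)) := by
  refine ⟨Set.subset_union_right, fun G hGsub ⟨hi, hne⟩ => ?_⟩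
  obtain ⟨C, hC⟩ := exists_cover α M k (insert b (s : Set V))
  set X := clIter α M K j (s : Set V) with hX
  set D := insert b (B ∪ G ∪ (G \ B).biUnion C) with hD
  have hBD : B ⊆ D := fun x hx => by simp [hD, hx]
  have hGD : G ⊆ D := fun x hx => by simp [hD, hx]
  have hbD : b ∈ D := Finset.mem_insert_self _ _
  have hCD : ∀ y ∈ G \ B, C y ⊆ D := fun y hy =>
    (Finset.subset_biUnion_of_mem C hy).trans
      (Finset.subset_union_right.trans (Finset.subset_insert _ _))
  have hBX : (B : Set V) ⊆ X := hBi.trans (clIter_mono hij.le)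
  set A := D.filter fun x => x ∈ X with hA
  have hBA : B ⊆ A := fun x hx => Finset.mem_filter.2 ⟨hBD hx, hBX hx⟩
  have hGF : ∀ x ∈ G, x ∉ B → x ∈ cl α M k (insert b (s : Set V)) ∧ x ∉ X := fun x hx hxB =>
    (hGsub hx).resolve_right hxB
  have hDcl : ∀ x ∈ D, x ∉ B → x ∈ cl α M k (insert b (s : Set V)) := by
    intro x hx hxB
    simp only [hD, Finset.mem_insert, Finset.mem_union, Finset.mem_biUnion] at hx
    rcases hx with rfl | (hx | hx) | ⟨y, -, hx⟩
    · exact subset_cl _ (Set.mem_insert _ _)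
    · exact absurd hx hxB
    · exact (hGF x hx hxB).1
    · exact (hC y).2.2.1 hx
  obtain ⟨E, hGE, hED, hE, hEw⟩ := exists_maximal_lei hα (hi.union hα hBA)
    (Finset.union_subset (Finset.filter_subset _ D) hGD)
  have hAE : A ⊆ E := Finset.subset_union_left.trans hGE
  have hGE : G ⊆ E := Finset.subset_union_right.trans hGE
  obtain ⟨w, hwG, hwB⟩ := Finset.exists_of_ssubset (hi.1.ssubset_of_ne hne)
  have hAE' : A ≠ E := fun h => (hGF w hwG hwB).2 (Finset.mem_filter.1 (h.symm ▸ hGE hwG)).2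
  -- Each vertex of `S₁` gives its own long edge of `D` over `E`, whence `|S₁| ≤ c`.
  set S₁ := E.filter fun x => ∃ y ∈ D, y ∉ E ∧ M.Adj x y with hS₁
  have hS₁c : S₁.card ≤ c := by
    by_cases hEeq : E = D
    · have : S₁ = ∅ := by
        rw [Finset.eq_empty_iff_forall_notMem]
        intro x hx
        obtain ⟨-, y, hy, hyE, -⟩ := Finset.mem_filter.1 hx
        exact hyE (hEeq ▸ hy)
      simp [this]
    obtain ⟨r, hr⟩ := hEw hEeq
    have hle := card_longEdges_le hδα hk hED hbD (fun z hz hzE hzb => by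
      simp only [hD, Finset.mem_insert, Finset.mem_union, Finset.mem_biUnion] at hz
      rcases hz with hz | (hz | hz) | ⟨y, hy, hz⟩
      · exact absurd hz hzb
      · exact absurd (hAE (hBA hz)) hzE
      · exact absurd (hGE hz) hzE
      · obtain ⟨-, h1, -, P, hP, hPC⟩ := hC y
        refine ⟨C y, hCD y hy, hz, h1, hPC.mono_base (fun x hx => ?_) Finset.inter_subset_left⟩
        rw [Finset.mem_inter, Finset.mem_insert]
        exact ⟨hPC.1 hx, (hP hx).imp id fun h => hAE (hBA (hsB h))⟩) hr
    refine le_trans ?_ (le_of_mul_le_one hδ hc hle)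
    have hex : ∀ x, ∃ y, x ∈ S₁ → y ∈ D ∧ y ∉ E ∧ M.Adj x y := by
      intro x
      by_cases hx : x ∈ S₁
      · obtain ⟨-, y, hy⟩ := Finset.mem_filter.1 hx
        exact ⟨y, fun _ => hy⟩
      · exact ⟨x, fun h => absurd h hx⟩
    choose f hf using hex
    refine Finset.card_le_card_of_injOn (fun x => s(x, f x)) (fun x hx => ?_) ?_
    · have hxE : x ∈ E := (Finset.mem_filter.1 hx).1
      obtain ⟨h1, h2, h3⟩ := hf x hx
      exact mk_mem_longEdges.2 ⟨hED hxE, h1, h3, fun h => h2 h.2, fun h => h.1 hxE⟩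
    · intro x hx y hy hxy
      rcases Sym2.eq_iff.1 hxy with h | h
      · exact h.1
      · exact absurd (h.1 ▸ (Finset.mem_filter.1 hx).1) (hf y hy).2.1
  set S := S₁ ∪ E.filter fun x => x = b with hS
  have hSE : S ⊆ E := Finset.union_subset (Finset.filter_subset _ _) (Finset.filter_subset _ _)
  have hSc : S.card ≤ c + 1 := by
    refine (Finset.card_union_le _ _).trans (add_le_add hS₁c ?_)
    exact (Finset.card_le_card (t := {b}) fun x hx => by
      simpa using (Finset.mem_filter.1 hx).2).trans (by simp)
  -- Vertices of `E` outside `S₁` have no neighbours in `D \ E`, so the witnesses can be cut down to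
  -- `E`.
  have hcov : ∀ z ∈ E, z ∉ A → z ∉ S →
      ∃ C' ⊆ E, z ∈ C' ∧ C'.card ≤ k ∧ LEi α M (C' ∩ (A ∪ S)) C' := by
    intro z hz hzA hzS
    have hzy : ∃ y ∈ G \ B, z ∈ C y := by
      have hzD := hED hz
      simp only [hD, Finset.mem_insert, Finset.mem_union, Finset.mem_biUnion] at hzD
      have hzb : z ≠ b := fun h => hzS (Finset.mem_union_right _ (Finset.mem_filter.2 ⟨hz, h⟩))
      have hzB : z ∉ B := fun h => hzA (hBA h)
      rcases hzD with h | (h | h) | h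
      · exact absurd h hzb
      · exact absurd h hzB
      · refine ⟨z, Finset.mem_sdiff.2 ⟨h, hzB⟩, (hC z).1 (hGF z h hzB).1 ?_⟩
        rintro (h' | h')
        · exact hzb h'
        · exact hzB (hsB h')
      · exact h
    obtain ⟨y, hy, hzy⟩ := hzy
    obtain ⟨-, h1, -, P, hP, hPC⟩ := hC y
    refine ⟨C y ∩ E, Finset.inter_subset_right, Finset.mem_inter.2 ⟨hzy, hz⟩,
      (Finset.card_le_card Finset.inter_subset_left).trans h1,
      hPC.restrict hα Finset.inter_subset_left Finset.inter_subset_left (fun x hx => ?_)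
        fun x hx y' hy' hxy => ?_⟩
    · simp only [Finset.mem_inter] at hx
      simp only [Finset.mem_inter, Finset.mem_union]
      refine ⟨hx.2, (hP hx.1).symm.imp (fun h => hBA (hsB h)) fun h => ?_⟩
      exact Finset.mem_union_right _ (Finset.mem_filter.2 ⟨hx.2.2, h⟩)
    · rw [Finset.mem_sdiff] at hx hy'
      refine hx.2 (Finset.mem_inter.2 ⟨hx.1, Finset.mem_union_right _
        (Finset.mem_union_left _ (Finset.mem_filter.2 ⟨(Finset.mem_inter.1 hx.1).2, y',
          hCD y hy hy'.1, fun h => hy'.2 (Finset.mem_inter.2 ⟨hy'.1, h⟩), hxy⟩))⟩)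
  obtain ⟨D₀, hD₀E, hD₀N, hD₀⟩ := hN A E S hSE hSc hcov (hE.ltc hAE')
  obtain ⟨P, hPD₀, hP, hAP⟩ := hD₀.exists_lei hα
  have hPD : P ⊆ D := hPD₀.trans (hD₀E.trans hED)
  -- As `B` contains every neighbour in `X` of `P \ A`, the base `A` of unbounded size can be
  -- replaced by `B`.
  have hUP : B ∪ P \ A ⊆ P := Finset.union_subset (hBA.trans hP.1) Finset.sdiff_subset
  have hnX : ∀ x ∈ P, x ∉ A → x ∉ X := fun x hx hxA h =>
    hxA (Finset.mem_filter.2 ⟨hPD hx, h⟩)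
  have hBU : LEi α M B (B ∪ P \ A) := by
    refine hP.restrict hα hUP Finset.subset_union_left (fun x hx => ?_) fun x hx y hy hxy => ?_
    · simp only [Finset.mem_inter, Finset.mem_union, Finset.mem_sdiff] at hx
      tauto
    · simp only [Finset.mem_union, Finset.mem_sdiff, not_or, not_and, not_not] at hx hy
      have hxP := hx.1.resolve_left hx.2
      exact hy.2.1 (hB y x ⟨(Finset.mem_filter.1 (hy.2.2 hy.1)).2, hDcl x (hPD hxP.1) hx.2,
        hnX x hxP.1 hxP.2, hxy.symm⟩)
  have hUcard : (B ∪ P \ A).card ≤ K := by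
    refine (Finset.card_union_le _ _).trans (le_trans ?_ hBK)
    exact Nat.add_le_add_left ((Finset.card_le_card
      (Finset.sdiff_subset_sdiff hPD₀ subset_rfl)).trans hD₀N) _
  have hUX : ((B ∪ P \ A : Finset V) : Set V) ⊆ X :=
    (subset_cl_of_lei hBU hBi hUcard).trans (clIter_mono (i := i + 1) hij)
  obtain ⟨v, hvP, hvA⟩ := Finset.exists_of_ssubset (hP.1.ssubset_of_ne hAP)
  exact hnX v hvP hvA (hUX (Finset.mem_coe.2 (Finset.mem_union_right _
    (Finset.mem_sdiff.2 ⟨hvP, hvA⟩))))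

end Strong

end WeightedGraph

/-! ### Choice of the constants and conclusion. -/

theorem lemma3p11 (α : ℝ) (hα : Irrational α) (hα0 : 0 < α) (hα1 : α < 1) (k m ℓ : ℕ) :
    ∃ mstar kstar tstar : ℕ,
      ∀ (V : Type*) (M : SimpleGraph V) (a : List V) (b : V), a.length ≤ ℓ →
        b ∉ WeightedGraph.clIter α M kstar mstar {x | x ∈ a} →
        ∃ (m' : ℕ) (B : Finset V), m' + m ≤ mstar ∧
          B.card ≤ tstar ∧
          {x | x ∈ a} ⊆ (B : Set V) ∧
          (B : Set V) ⊆ WeightedGraph.cl α M k (B : Set V) ∧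
          WeightedGraph.cl α M k (B : Set V) ⊆
            WeightedGraph.clIter α M kstar m' {x | x ∈ a} ∧
          WeightedGraph.FreeOver M
            (WeightedGraph.clIter α M kstar (m' + m) {x | x ∈ a})
            ((WeightedGraph.cl α M k (insert b {x | x ∈ a}) \
              WeightedGraph.clIter α M kstar (m' + m) {x | x ∈ a}) ∪ (B : Set V))
            (B : Set V) ∧
          WeightedGraph.LEs α M B
            ((WeightedGraph.cl α M k (insert b {x | x ∈ a}) \
              WeightedGraph.clIter α M kstar (m' + m) {x | x ∈ a}) ∪ (B : Set V)) := by
  obtain ⟨δ, hδ, hδα, hk⟩ := WeightedGraph.exists_gap hα0 k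
  obtain ⟨c, hc⟩ := exists_nat_gt (1 / δ)
  have hc' : 1 < δ * (c + 1) := by
    rw [div_lt_iff₀ hδ] at hc
    linarith
  obtain ⟨N, hN⟩ := WeightedGraph.exists_bounded_ltc hα0.le hδ hδα hk (c + 1)
  obtain ⟨L, hL⟩ := WeightedGraph.exists_stable_boundary hα0.le hδ hδα hk hc' ℓ m
  -- The summands secure `k ≤ K`, `|B| + N ≤ K` and the size needed in `crossing_finite`; none of
  -- `c`, `N`, `L` depends on `K`.
  set K := k + (ℓ + c + N) + (ℓ + 1 + (c + 1) * (k + 1)) with hK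
  refine ⟨L, K, ℓ + c, fun V M a b ha hb => ?_⟩
  classical
  have hs : {x | x ∈ a} = ((a.toFinset : Finset V) : Set V) := by
    ext x
    simp
  have hsc : a.toFinset.card ≤ ℓ := (List.toFinset_card_le a).trans ha
  rw [hs] at hb ⊢
  generalize a.toFinset = s at hb hsc ⊢
  obtain ⟨i, hiL, hi⟩ := hL V M K (by omega) (by omega) s hsc b hb
  have hbj : b ∉ WeightedGraph.clIter α M K (i + (m + 1)) (s : Set V) :=
    fun h => hb (WeightedGraph.clIter_mono hiL h)
  obtain ⟨hfin, hcard⟩ := WeightedGraph.crossing_finite hα0.le hδ hδα hk hc'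
    (show ℓ + 1 + (c + 1) * (k + 1) ≤ K by omega) hsc (show i < i + (m + 1) by omega) hbj
  set B : Finset V := s ∪ hfin.toFinset.image Prod.fst with hBdef
  have hBi : (B : Set V) ⊆ WeightedGraph.clIter α M K i (s : Set V) := by
    intro x hx
    rcases Finset.mem_union.1 (Finset.mem_coe.1 hx) with h | h
    · exact WeightedGraph.clIter_mono (Nat.zero_le i) h
    · obtain ⟨p, hp, rfl⟩ := Finset.mem_image.1 h
      exact ((Set.Finite.mem_toFinset hfin).1 hp).1
  have hBcard : B.card ≤ ℓ + c := by
    refine (Finset.card_union_le _ _).trans (add_le_add hsc (Finset.card_image_le.trans ?_))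
    rwa [← Set.ncard_eq_toFinset_card _ hfin]
  have hB : ∀ x y, (x, y) ∈ WeightedGraph.crossing α M k K s b (i + (m + 1)) (i + (m + 1)) →
      x ∈ B := fun x y hxy => Finset.mem_union_right _ (Finset.mem_image.2 ⟨(x, y),
    (Set.Finite.mem_toFinset hfin).2 ⟨hi x y hxy, hxy.2⟩, rfl⟩)
  have hm : i + 1 + m = i + (m + 1) := by omega
  -- The stage is `i + 1`, not `i`, to make room for `cl^k(B)`; this is why the stable gap is `m +
  -- 1`.
  refine ⟨i + 1, B, hm ▸ hiL, hBcard, ?_, WeightedGraph.subset_cl _,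
    WeightedGraph.cl_mono (by omega) hBi, ?_, ?_⟩
  · exact Finset.coe_subset.2 Finset.subset_union_left
  · rw [hm]
    refine ⟨?_, fun x hx y hy hxy => hx.2 (hB x y ⟨hx.1, ?_, ?_, hxy⟩)⟩
    · ext x
      refine ⟨fun h => h.2.resolve_left fun h' => h'.2 h.1, fun h => ⟨?_, Or.inr h⟩⟩
      exact WeightedGraph.clIter_mono (by omega) (hBi h)
    · exact (hy.1.resolve_right hy.2).1
    · exact (hy.1.resolve_right hy.2).2
  · rw [hm]
    exact WeightedGraph.les_of_boundary_subset hα0.le hδ hδα hk hc' (hN V M)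
      (show i < i + (m + 1) by omega) Finset.subset_union_left hBi (by omega) hB
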